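/- Let $K$ be a field, let $H$ be a Hopf algebra over $K$ with multiplication $m$, comultiplication $\Delta$ and counit $\varepsilon$, and let $H^+=\ker\varepsilon$ be its augmentation ideal. Write $\mathfrak M_K$ for the category of $K$-vector spaces and $\mathfrak M^H$ for the monoidal category of right $H$-comodules, where the tensor product over $K$ has the codiagonal coaction $v\otimes w\mapsto v_{0}\otimes w_{0}\otimes v_{1}w_{1}$; $H$ is an algebra in $\mathfrak M^H$ through the coaction $\Delta$. For $\mathcal M=\mathfrak M_K$ or $\mathcal M=\mathfrak M^H$ and an algebra $A$ in $\mathcal M$, let $\Omega^1A$ be the kernel of the multiplication $A\otimes A\to A$, an $A$-bimodule in $\mathcal M$. The algebra $A$ is *formally smooth in $\mathcal M$* if for every morphism $f:B\to C$ of $A$-bimodules in $\mathcal M$ that has a section in $\mathcal M$ (not necessarily a bimodule map), every morphism $\Omega^1A\to C$ of $A$-bimodules in $\mathcal M$ factors through $f$ by a morphism $\Omega^1A\to B$ of $A$-bimodules in $\mathcal M$. An *$fs$-section* is a $K$-linear map $\tau:H^+\to H\otimes H^+$ such that, for all $h\in H$ and $x\in H^+$, writing $\tau(x)=\sum_i a_i\otimes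 b_i$, one has $\tau(hx)=\sum_i ha_i\otimes b_i$ and $\sum_i a_ib_i=x$. A ring is *left hereditary* if every submodule of a projective left module is projective, and *hereditary* if this holds both for left modules and for right modules. **Proposition.** The following assertions are equivalent: (a) $H$ is formally smooth as an algebra in $\mathfrak M_K$; (b) $H$ is formally smooth as an algebra in $\mathfrak M^H$; (c) $H^+$ is projective as a left $H$-module; (d) there exists an $fs$-section $\tau:H^+\to H\otimes H^+$; (e) $H$ is left hereditary; (e$'$) $H$ is hereditary. Moreover, if $H$ is finite-dimensional over $K$, they are also equivalent to: (f) the multiplication $H^+\otimes H^+\to H^+$ has a left $H$-linear section, where $H$ acts on $H^+\otimes H^+$ by left multiplication on the first factor. -/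

import Mathlib

open scoped TensorProduct

/-! ### Bimodules over an algebra and formally smooth algebras -/

section Bimodules

variable (K : Type*) [Field K] (A : Type*) [Ring A] [Algebra K A]

/-- An `A`-bimodule structure on the `K`-vector space `B`: a left action and a right action of `A`,
both `K`-linear in each variable, which commute with each other. -/
structure BimoduleStr (B : Type*) [AddCommMonoid B] [Module K B] where
  /-- the left action, `lact a b = a b` -/
  lact : A →ₗ[K] B →ₗ[K] B
  /-- the right action, `ract a b = b a` -/
  ract : A →ₗ[K] B →ₗ[K] B
  one_lact : ∀ b, lact 1 b = b
  mul_lact : ∀ a a' b, lact (a * a') b = lact a (lact a' b)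
  one_ract : ∀ b, ract 1 b = b
  mul_ract : ∀ a a' b, ract (a * a') b = ract a' (ract a b)
  lact_ract : ∀ a a' b, lact a (ract a' b) = ract a' (lact a b)

variable {K A}

/-- `K`-linear maps which are morphisms of `A`-bimodules. -/
structure IsBimoduleHom {B C : Type*} [AddCommMonoid B] [Module K B] [AddCommMonoid C] [Module K C]
    (SB : BimoduleStr K A B) (SC : BimoduleStr K A C) (f : B →ₗ[K] C) : Prop where
  map_lact : ∀ a b, f (SB.lact a b) = SC.lact a (f b)
  map_ract : ∀ a b, f (SB.ract a b) = SC.ract a (f b)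

variable (K A)

/-- The `A`-bimodule `A ⊗ A`, with `a (x ⊗ y) a' = a x ⊗ y a'`. -/
noncomputable def tensorSquareBimodule : BimoduleStr K A (A ⊗[K] A) where
  lact := LinearMap.rTensorHom A ∘ₗ LinearMap.mul K A
  ract := LinearMap.lTensorHom A ∘ₗ (LinearMap.mul K A).flip
  one_lact b := by
    induction b with
    | zero => simp
    | tmul x y => simp
    | add x y hx hy => rw [map_add, hx, hy]
  mul_lact a a' b := by
    induction b with
    | zero => simp
    | tmul x y => simp [mul_assoc]
    | add x y hx hy => simp only [map_add, hx, hy]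
  one_ract b := by
    induction b with
    | zero => simp
    | tmul x y => simp
    | add x y hx hy => rw [map_add, hx, hy]
  mul_ract a a' b := by
    induction b with
    | zero => simp
    | tmul x y => simp [mul_assoc]
    | add x y hx hy => simp only [map_add, hx, hy]
  lact_ract a a' b := by
    induction b with
    | zero => simp
    | tmul x y => simp
    | add x y hx hy => simp only [map_add, hx, hy]

@[simp] theorem tensorSquareBimodule_lact_tmul (a x y : A) :
    (tensorSquareBimodule K A).lact a (x ⊗ₜ[K] y) = (a * x) ⊗ₜ[K] y := rfl

@[simp] theorem tensorSquareBimodule_ract_tmul (a x y : A) :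
    (tensorSquareBimodule K A).ract a (x ⊗ₜ[K] y) = x ⊗ₜ[K] (y * a) := rfl

/-- `Ω¹A`, the kernel of the multiplication `A ⊗ A → A`. -/
noncomputable abbrev OmegaOne : Submodule K (A ⊗[K] A) := LinearMap.ker (LinearMap.mul' K A)

theorem mul'_lact (a : A) (t : A ⊗[K] A) :
    LinearMap.mul' K A ((tensorSquareBimodule K A).lact a t) = a * LinearMap.mul' K A t := by
  induction t with
  | zero => simp
  | tmul x y => simp [mul_assoc]
  | add x y hx hy => simp only [map_add, hx, hy, mul_add]

theorem mul'_ract (a : A) (t : A ⊗[K] A) :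
    LinearMap.mul' K A ((tensorSquareBimodule K A).ract a t) = LinearMap.mul' K A t * a := by
  induction t with
  | zero => simp
  | tmul x y => simp [mul_assoc]
  | add x y hx hy => simp only [map_add, hx, hy, add_mul]

/-- `Ω¹A` as a sub-bimodule of `A ⊗ A`. -/
noncomputable def omegaOneBimodule : BimoduleStr K A (OmegaOne K A) where
  lact := LinearMap.mk₂ K
    (fun a w => ⟨(tensorSquareBimodule K A).lact a w, by
      rw [LinearMap.mem_ker, mul'_lact, LinearMap.mem_ker.1 w.2, mul_zero]⟩)
    (fun a a' w => Subtype.ext (by simp)) (fun c a w => Subtype.ext (by simp))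
    (fun a w w' => Subtype.ext (by simp)) (fun c a w => Subtype.ext (by simp))
  ract := LinearMap.mk₂ K
    (fun a w => ⟨(tensorSquareBimodule K A).ract a w, by
      rw [LinearMap.mem_ker, mul'_ract, LinearMap.mem_ker.1 w.2, zero_mul]⟩)
    (fun a a' w => Subtype.ext (by simp)) (fun c a w => Subtype.ext (by simp))
    (fun a w w' => Subtype.ext (by simp)) (fun c a w => Subtype.ext (by simp))
  one_lact _ := Subtype.ext ((tensorSquareBimodule K A).one_lact _)
  mul_lact _ _ _ := Subtype.ext ((tensorSquareBimodule K A).mul_lact _ _ _)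
  one_ract _ := Subtype.ext ((tensorSquareBimodule K A).one_ract _)
  mul_ract _ _ _ := Subtype.ext ((tensorSquareBimodule K A).mul_ract _ _ _)
  lact_ract _ _ _ := Subtype.ext ((tensorSquareBimodule K A).lact_ract _ _ _)

end Bimodules

/-- `A` is formally smooth as an algebra in the category of `K`-vector spaces: the bimodule `Ω¹A`
has the lifting property with respect to every morphism `f` of `A`-bimodules that has a `K`-linear
section. -/
def IsFormallySmoothAlg.{u, v} (K : Type u) [Field K] (A : Type v) [Ring A] [Algebra K A] : Prop :=
  ∀ (B C : Type v) [AddCommGroup B] [Module K B] [AddCommGroup C] [Module K C]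
    (SB : BimoduleStr K A B) (SC : BimoduleStr K A C) (f : B →ₗ[K] C),
    IsBimoduleHom SB SC f → (∃ s : C →ₗ[K] B, f ∘ₗ s = LinearMap.id) →
    ∀ g : OmegaOne K A →ₗ[K] C, IsBimoduleHom (omegaOneBimodule K A) SC g →
      ∃ l : OmegaOne K A →ₗ[K] B, IsBimoduleHom (omegaOneBimodule K A) SB l ∧ f ∘ₗ l = g

/-! ### Right comodules, algebras in right comodules and their bimodules -/

section Comodules

variable (K : Type*) [Field K] (H : Type*) [Ring H] [HopfAlgebra K H]

/-- A right `H`-comodule structure on the `K`-vector space `V`. -/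
structure RightComoduleStr (V : Type*) [AddCommMonoid V] [Module K V] where
  coact : V →ₗ[K] V ⊗[K] H
  coassoc : (TensorProduct.assoc K V H H).toLinearMap ∘ₗ coact.rTensor H ∘ₗ coact =
    (Coalgebra.comul (R := K) (A := H)).lTensor V ∘ₗ coact
  counit_coact : (TensorProduct.rid K V).toLinearMap ∘ₗ
    (Coalgebra.counit (R := K) (A := H)).lTensor V ∘ₗ coact = LinearMap.id

variable {K H}

/-- `f` is right `H`-colinear. -/
def IsColinear {V W : Type*} [AddCommMonoid V] [Module K V] [AddCommMonoid W] [Module K W]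
    (RV : RightComoduleStr K H V) (RW : RightComoduleStr K H W) (f : V →ₗ[K] W) : Prop :=
  RW.coact ∘ₗ f = f.rTensor H ∘ₗ RV.coact

/-- The codiagonal coaction `v ⊗ w ↦ v₀ ⊗ w₀ ⊗ v₁ w₁`, for linear maps `r v = v₀ ⊗ v₁` and
`s w = w₀ ⊗ w₁`. -/
noncomputable def codiag {V W : Type*} [AddCommMonoid V] [Module K V] [AddCommMonoid W] [Module K W]
    (r : V →ₗ[K] V ⊗[K] H) (s : W →ₗ[K] W ⊗[K] H) : V ⊗[K] W →ₗ[K] (V ⊗[K] W) ⊗[K] H :=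
  (LinearMap.mul' K H).lTensor (V ⊗[K] W) ∘ₗ
    (TensorProduct.tensorTensorTensorComm K V H W H).toLinearMap ∘ₗ TensorProduct.map r s

/-- The tensor product of two right `H`-comodules. -/
noncomputable def RightComoduleStr.tensor {V W : Type*} [AddCommMonoid V] [Module K V]
    [AddCommMonoid W] [Module K W] (RV : RightComoduleStr K H V) (RW : RightComoduleStr K H W) :
    RightComoduleStr K H (V ⊗[K] W) where
  coact := codiag RV.coact RW.coact
  coassoc := by
    have key : ∀ (x : V ⊗[K] H) (y : W ⊗[K] H),
        (TensorProduct.assoc K (V ⊗[K] W) H H) ((codiag RV.coact RW.coact).rTensor H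
          ((LinearMap.mul' K H).lTensor (V ⊗[K] W)
            (TensorProduct.tensorTensorTensorComm K V H W H (x ⊗ₜ y)))) =
        TensorProduct.map LinearMap.id (LinearMap.mul' K (H ⊗[K] H))
          (TensorProduct.tensorTensorTensorComm K V (H ⊗[K] H) W (H ⊗[K] H)
            ((TensorProduct.assoc K V H H (RV.coact.rTensor H x)) ⊗ₜ
              (TensorProduct.assoc K W H H (RW.coact.rTensor H y)))) := by
      intro x y
      induction x with
      | zero => simp
      | add x x' hx hx' => simp only [map_add, TensorProduct.add_tmul, hx, hx']
      | tmul v h =>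
        induction y with
        | zero => simp
        | add y y' hy hy' => simp only [map_add, TensorProduct.tmul_add, hy, hy']
        | tmul w k =>
          simp only [codiag, LinearMap.rTensor_tmul, LinearMap.lTensor_tmul,
            TensorProduct.tensorTensorTensorComm_tmul, LinearMap.mul'_apply,
            LinearMap.comp_apply, TensorProduct.map_tmul, LinearEquiv.coe_coe]
          generalize RV.coact v = p
          generalize RW.coact w = q
          induction p with
          | zero => simp
          | add x x' hx hx' => simp only [map_add, TensorProduct.add_tmul, hx, hx']
          | tmul v' h' =>
            induction q with
            | zero => simp
            | add x x' hx hx' =>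
              simp only [map_add, TensorProduct.add_tmul, TensorProduct.tmul_add, hx, hx']
            | tmul w' k' => simp
    have key2 : ∀ (x : V ⊗[K] H) (y : W ⊗[K] H),
        (Coalgebra.comul (R := K) (A := H)).lTensor (V ⊗[K] W)
          ((LinearMap.mul' K H).lTensor (V ⊗[K] W)
            (TensorProduct.tensorTensorTensorComm K V H W H (x ⊗ₜ y))) =
        TensorProduct.map LinearMap.id (LinearMap.mul' K (H ⊗[K] H))
          (TensorProduct.tensorTensorTensorComm K V (H ⊗[K] H) W (H ⊗[K] H)
            (((Coalgebra.comul (R := K) (A := H)).lTensor V x) ⊗ₜ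
              ((Coalgebra.comul (R := K) (A := H)).lTensor W y))) := by
      intro x y
      induction x with
      | zero => simp
      | add x x' hx hx' => simp only [map_add, TensorProduct.add_tmul, hx, hx']
      | tmul v h =>
        induction y with
        | zero => simp
        | add y y' hy hy' => simp only [map_add, TensorProduct.tmul_add, hy, hy']
        | tmul w k => simp
    refine TensorProduct.ext' fun v w => ?_
    have hv := LinearMap.congr_fun RV.coassoc v
    have hw := LinearMap.congr_fun RW.coassoc w
    simp only [LinearMap.comp_apply, LinearEquiv.coe_coe] at hv hw
    have h1 := key (RV.coact v) (RW.coact w)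
    rw [hv, hw, ← key2] at h1
    simpa [codiag] using h1
  counit_coact := by
    have key : ∀ (x : V ⊗[K] H) (y : W ⊗[K] H),
        TensorProduct.rid K (V ⊗[K] W) ((Coalgebra.counit (R := K) (A := H)).lTensor (V ⊗[K] W)
          ((LinearMap.mul' K H).lTensor (V ⊗[K] W)
            (TensorProduct.tensorTensorTensorComm K V H W H (x ⊗ₜ y)))) =
        (TensorProduct.rid K V ((Coalgebra.counit (R := K) (A := H)).lTensor V x)) ⊗ₜ
          (TensorProduct.rid K W ((Coalgebra.counit (R := K) (A := H)).lTensor W y)) := by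
      intro x y
      induction x with
      | zero => simp
      | add x x' hx hx' => simp only [map_add, TensorProduct.add_tmul, hx, hx']
      | tmul v h =>
        induction y with
        | zero => simp
        | add y y' hy hy' => simp only [map_add, TensorProduct.tmul_add, hy, hy']
        | tmul w k =>
          simp only [TensorProduct.tensorTensorTensorComm_tmul, LinearMap.lTensor_tmul,
            LinearMap.mul'_apply, Bialgebra.counit_mul, TensorProduct.rid_tmul,
            TensorProduct.smul_tmul_smul]
    refine TensorProduct.ext' fun v w => ?_
    have hv := LinearMap.congr_fun RV.counit_coact v
    have hw := LinearMap.congr_fun RW.counit_coact w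
    simp only [LinearMap.comp_apply, LinearEquiv.coe_coe, LinearMap.id_apply] at hv hw
    have h1 := key (RV.coact v) (RW.coact w)
    rw [hv, hw] at h1
    simpa [codiag] using h1

variable (K H)

/-- The regular right comodule: `H` coacting on itself by its comultiplication. -/
noncomputable def regularComodule : RightComoduleStr K H H where
  coact := Coalgebra.comul
  coassoc := Coalgebra.coassoc
  counit_coact := by
    ext x
    simp

variable {K H} {A : Type*} [Ring A] [Algebra K A]

/-- The `K`-algebra `A`, with the right coaction `RA`, is an algebra in the monoidal category of
right `H`-comodules: its unit `K → A` and its multiplication `A ⊗ A → A` are colinear. -/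
structure IsComoduleAlgebra (RA : RightComoduleStr K H A) : Prop where
  coact_one : RA.coact 1 = 1 ⊗ₜ[K] 1
  colinear_mul : IsColinear (RA.tensor RA) RA (LinearMap.mul' K A)

/-- The `A`-bimodule `B`, with the right coaction `RB`, is an `A`-bimodule in the monoidal category
of right `H`-comodules: both action maps `A ⊗ B → B` and `B ⊗ A → B` are colinear. -/
structure IsComoduleBimodule (RA : RightComoduleStr K H A) {B : Type*} [AddCommMonoid B] [Module K B]
    (SB : BimoduleStr K A B) (RB : RightComoduleStr K H B) : Prop where
  colinear_lact : IsColinear (RA.tensor RB) RB (TensorProduct.lift SB.lact)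
  colinear_ract : IsColinear (RB.tensor RA) RB (TensorProduct.lift SB.ract.flip)

variable (K H)

/-- A Hopf algebra is an algebra in the category of its right comodules. -/
theorem regularComodule_isComoduleAlgebra : IsComoduleAlgebra (regularComodule K H) where
  coact_one := by simp [regularComodule, Algebra.TensorProduct.one_def]
  colinear_mul := by
    refine TensorProduct.ext' fun x y => ?_
    simp only [regularComodule, RightComoduleStr.tensor, codiag, LinearMap.comp_apply,
      LinearMap.mul'_apply, TensorProduct.map_tmul, LinearEquiv.coe_coe, Bialgebra.comul_mul]
    generalize Coalgebra.comul (R := K) x = p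
    generalize Coalgebra.comul (R := K) y = q
    induction p with
    | zero => simp
    | add x x' hx hx' => simp only [map_add, TensorProduct.add_tmul, add_mul, hx, hx']
    | tmul a b =>
      induction q with
      | zero => simp
      | add x x' hx hx' => simp only [map_add, TensorProduct.tmul_add, mul_add, hx, hx']
      | tmul c d => simp

variable {K H}

section Kernel

variable {V W : Type*} [AddCommMonoid V] [Module K V] [AddCommMonoid W] [Module K W]

theorem rTensor_subtype_injective (N : Submodule K V) (M : Type*) [AddCommGroup M] [Module K M] :
    Function.Injective (N.subtype.rTensor M) :=
  Module.Flat.rTensor_preserves_injective_linearMap _ N.injective_subtype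

theorem coact_mem_range_of_mem_ker (RV : RightComoduleStr K H V) (RW : RightComoduleStr K H W)
    (f : V →ₗ[K] W) (hf : IsColinear RV RW f) (x : LinearMap.ker f) :
    RV.coact x ∈ LinearMap.range ((LinearMap.ker f).subtype.rTensor H) := by
  let _ : AddCommGroup V := Module.addCommMonoidToAddCommGroup K
  let _ : AddCommGroup W := Module.addCommMonoidToAddCommGroup K
  have hex : Function.Exact (LinearMap.ker f).subtype f.rangeRestrict := by
    rw [LinearMap.exact_iff]; simp
  have h2 := rTensor_exact H hex f.surjective_rangeRestrict
  refine (h2 _).1 (rTensor_subtype_injective (LinearMap.range f) H ?_)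
  rw [map_zero, ← LinearMap.comp_apply, ← LinearMap.rTensor_comp]
  have h3 := LinearMap.congr_fun hf (x : V)
  simp only [LinearMap.comp_apply, LinearMap.mem_ker.1 x.2, map_zero] at h3
  exact h3.symm

/-- The coaction induced on the kernel of a colinear map: the unique one for which the inclusion of
the kernel is colinear. -/
noncomputable def kerCoact (RV : RightComoduleStr K H V) (RW : RightComoduleStr K H W)
    (f : V →ₗ[K] W) (hf : IsColinear RV RW f) :
    LinearMap.ker f →ₗ[K] LinearMap.ker f ⊗[K] H :=
  (LinearEquiv.ofInjective _ (rTensor_subtype_injective (LinearMap.ker f) H)).symm.toLinearMap ∘ₗ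
    (RV.coact ∘ₗ (LinearMap.ker f).subtype).codRestrict _
      (coact_mem_range_of_mem_ker RV RW f hf)

theorem rTensor_kerCoact (RV : RightComoduleStr K H V) (RW : RightComoduleStr K H W)
    (f : V →ₗ[K] W) (hf : IsColinear RV RW f) :
    (LinearMap.ker f).subtype.rTensor H ∘ₗ kerCoact RV RW f hf =
      RV.coact ∘ₗ (LinearMap.ker f).subtype := by
  ext x
  simp only [kerCoact, LinearMap.comp_apply, LinearEquiv.coe_coe]
  have := LinearEquiv.apply_symm_apply
    (LinearEquiv.ofInjective _ (rTensor_subtype_injective (LinearMap.ker f) H))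
    ((RV.coact ∘ₗ (LinearMap.ker f).subtype).codRestrict _
      (coact_mem_range_of_mem_ker RV RW f hf) x)
  exact congrArg Subtype.val this

/-- The kernel of a colinear map, as a subcomodule. -/
noncomputable def kerComodule (RV : RightComoduleStr K H V) (RW : RightComoduleStr K H W)
    (f : V →ₗ[K] W) (hf : IsColinear RV RW f) : RightComoduleStr K H (LinearMap.ker f) where
  coact := kerCoact RV RW f hf
  coassoc := by
    have h := rTensor_kerCoact RV RW f hf
    have hinj := rTensor_subtype_injective (LinearMap.ker f) (H ⊗[K] H)
    refine LinearMap.ext fun x => hinj ?_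
    have hx : (LinearMap.ker f).subtype.rTensor H (kerCoact RV RW f hf x) = RV.coact x :=
      LinearMap.congr_fun h x
    have e1 : ∀ t : LinearMap.ker f ⊗[K] H,
        (LinearMap.ker f).subtype.rTensor (H ⊗[K] H)
          (TensorProduct.assoc K _ H H ((kerCoact RV RW f hf).rTensor H t)) =
        TensorProduct.assoc K V H H
          (RV.coact.rTensor H ((LinearMap.ker f).subtype.rTensor H t)) := by
      intro t
      induction t with
      | zero => simp
      | add a b ha hb => simp only [map_add, ha, hb]
      | tmul a b =>
        have ha : (LinearMap.ker f).subtype.rTensor H (kerCoact RV RW f hf a) = RV.coact a :=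
          LinearMap.congr_fun h a
        simp only [LinearMap.rTensor_tmul, Submodule.subtype_apply, ← ha]
        generalize kerCoact RV RW f hf a = p
        induction p with
        | zero => simp
        | add a b ha hb => simp only [map_add, TensorProduct.add_tmul, ha, hb]
        | tmul c d => simp
    have e2 : ∀ t : LinearMap.ker f ⊗[K] H,
        (LinearMap.ker f).subtype.rTensor (H ⊗[K] H)
          ((Coalgebra.comul (R := K) (A := H)).lTensor _ t) =
        (Coalgebra.comul (R := K) (A := H)).lTensor V
          ((LinearMap.ker f).subtype.rTensor H t) := by
      intro t
      rw [← LinearMap.comp_apply, ← LinearMap.comp_apply, LinearMap.rTensor_comp_lTensor,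
        LinearMap.lTensor_comp_rTensor]
    simp only [LinearMap.comp_apply, LinearEquiv.coe_coe]
    rw [e1, e2, hx]
    exact LinearMap.congr_fun RV.coassoc (x : V)
  counit_coact := by
    have h := rTensor_kerCoact RV RW f hf
    refine LinearMap.ext fun x => Subtype.ext ?_
    have hx : (LinearMap.ker f).subtype.rTensor H (kerCoact RV RW f hf x) = RV.coact x :=
      LinearMap.congr_fun h x
    have e : ∀ t : LinearMap.ker f ⊗[K] H,
        ((TensorProduct.rid K (LinearMap.ker f)
          ((Coalgebra.counit (R := K) (A := H)).lTensor _ t) : LinearMap.ker f) : V) =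
        TensorProduct.rid K V ((Coalgebra.counit (R := K) (A := H)).lTensor V
          ((LinearMap.ker f).subtype.rTensor H t)) := by
      intro t
      induction t with
      | zero => simp
      | add a b ha hb => simp only [map_add, Submodule.coe_add, ha, hb]
      | tmul a b => simp
    simp only [LinearMap.comp_apply, LinearEquiv.coe_coe, LinearMap.id_apply]
    rw [e, hx]
    exact LinearMap.congr_fun RV.counit_coact (x : V)

end Kernel

/-- `Ω¹A` as a right `H`-comodule: the kernel of the multiplication `A ⊗ A → A`, where `A ⊗ A` has
the codiagonal coaction. -/
noncomputable def omegaOneComodule (RA : RightComoduleStr K H A) (hA : IsComoduleAlgebra RA) :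
    RightComoduleStr K H (OmegaOne K A) :=
  kerComodule (RA.tensor RA) RA (LinearMap.mul' K A) hA.colinear_mul

end Comodules

/-- The algebra `A` in right `H`-comodules is formally smooth in that category: the bimodule `Ω¹A`
has the lifting property with respect to every morphism `f` of `A`-bimodules in right `H`-comodules
that has a right `H`-colinear section. -/
def IsFormallySmoothComoduleAlg.{u, w, v} {K : Type u} [Field K] {H : Type w} [Ring H]
    [HopfAlgebra K H] {A : Type v} [Ring A] [Algebra K A] (RA : RightComoduleStr K H A)
    (hA : IsComoduleAlgebra RA) : Prop :=
  ∀ (B C : Type v) [AddCommGroup B] [Module K B] [AddCommGroup C] [Module K C]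
    (SB : BimoduleStr K A B) (RB : RightComoduleStr K H B)
    (SC : BimoduleStr K A C) (RC : RightComoduleStr K H C),
    IsComoduleBimodule RA SB RB → IsComoduleBimodule RA SC RC →
    ∀ f : B →ₗ[K] C, IsBimoduleHom SB SC f → IsColinear RB RC f →
    (∃ s : C →ₗ[K] B, IsColinear RC RB s ∧ f ∘ₗ s = LinearMap.id) →
    ∀ g : OmegaOne K A →ₗ[K] C, IsBimoduleHom (omegaOneBimodule K A) SC g →
      IsColinear (omegaOneComodule RA hA) RC g →
      ∃ l : OmegaOne K A →ₗ[K] B, IsBimoduleHom (omegaOneBimodule K A) SB l ∧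
        IsColinear (omegaOneComodule RA hA) RB l ∧ f ∘ₗ l = g

/-! ### The augmentation ideal, `fs`-sections and hereditary rings -/

section Augmentation

variable (K : Type*) [Field K] (H : Type*) [Ring H] [HopfAlgebra K H]

/-- The augmentation ideal `H⁺`, the kernel of the counit, as a left ideal. -/
noncomputable abbrev augmentationIdeal : Ideal H := RingHom.ker (Bialgebra.counitAlgHom K H)

/-- The left action `H ⊗ H⁺ → H⁺`, `a ⊗ b ↦ a b`. -/
noncomputable def augmentationAct :
    H ⊗[K] augmentationIdeal K H →ₗ[K] augmentationIdeal K H :=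
  TensorProduct.lift (Algebra.lsmul K K (augmentationIdeal K H)).toLinearMap

/-- The multiplication `H⁺ ⊗ H⁺ → H⁺`, `a ⊗ b ↦ a b`. -/
noncomputable def augmentationMul :
    augmentationIdeal K H ⊗[K] augmentationIdeal K H →ₗ[K] augmentationIdeal K H :=
  augmentationAct K H ∘ₗ
    ((augmentationIdeal K H).subtype.restrictScalars K).rTensor (augmentationIdeal K H)

theorem augmentationAct_tmul (a : H) (b : augmentationIdeal K H) :
    (augmentationAct K H (a ⊗ₜ b) : H) = a * b := rfl

theorem augmentationMul_tmul (a b : augmentationIdeal K H) :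
    (augmentationMul K H (a ⊗ₜ b) : H) = a * b := rfl

variable {K H}

/-- `fs`-sections; `H` acts on `H ⊗ H⁺` by multiplication on the first factor. -/
structure IsFsSection (τ : augmentationIdeal K H →ₗ[K] H ⊗[K] augmentationIdeal K H) : Prop where
  map_smul : ∀ (h : H) (x : augmentationIdeal K H), τ (h • x) = h • τ x
  mul_eq : ∀ x : augmentationIdeal K H, augmentationAct K H (τ x) = x

end Augmentation

/-- Left hereditary rings: submodules of projective left modules are projective. -/
def IsLeftHereditary.{v} (R : Type v) [Ring R] : Prop :=
  ∀ (P : Type v) [AddCommGroup P] [Module R P], Module.Projective R P →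
    ∀ N : Submodule R P, Module.Projective R N

/-- Hereditary rings: submodules of projective left modules, and of projective right modules, are
projective. -/
def IsHereditary.{v} (R : Type v) [Ring R] : Prop :=
  IsLeftHereditary R ∧ IsLeftHereditary Rᵐᵒᵖ

/-! Everything is phrased through derivations. Bimodule maps out of `Ω¹A` are the same as
derivations of `A`, so formal smoothness says that derivations lift along split morphisms of
bimodules; in comodules the same holds with colinear derivations and colinear sections.

For a Hopf algebra, convolution with the antipode trades a derivation `D : H → B` for `φ(h) = D(h₁)
S(h₂)`, a 1-cocycle for the adjoint action `h ▹ b = h₁ b S(h₂)`, and `D(h) = φ(h₁) h₂` recovers `D`.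
A cocycle is determined by its restriction to `H⁺`, which is `H`-linear. So an `fs`-section `τ`
lifts `φ`: compose `τ` with `a ⊗ b ↦ a ▹ s(φ(b))`, where `s` is the given section. Colinear
derivations correspond to cocycles with coinvariant values, which a colinear `s` and the adjoint
action preserve; the same formula therefore serves in both categories.

Conversely, a left `H`-module `V` gives an `H`-bimodule `V ⊗ H` in comodules, in which every
`K`-linear map of modules `V → W` becomes colinear. Lifting the derivation attached to the cocycle
`h ↦ h - ε(h)` along `(H ⊗ H⁺) ⊗ H → H⁺ ⊗ H` and applying `ε` to the last factor yields an
`fs`-section. Since `H ⊗ H⁺` is free, such a section exists exactly when `H⁺` is projective.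

Lifting of derivations implies hereditary for any algebra: a derivation into `Hom_K(Q, N)`
represents an extension class of `Q` by `N`, and lifting it to `Hom_K(Q, A ⊗ N)` forces `N` to be a
summand of the free module `A ⊗ N` (`LiftsDerivations.projective_of_exact`). Passage to the opposite
algebra gives the right-hand version, and `H⁺`, a left ideal, is projective over a left hereditary
`H`.

In finite dimension, the trivial module embeds in the free module `H ⊗ H`. If `H` is left hereditary
this line is projective, which produces a left integral `e` with `ε(e) = 1`; then `x ↦ x ⊗ (1 - e)`
is the section in (f). -/

/-! ### Derivations and formal smoothness -/

section Derivations

variable {K : Type*} [Field K] {A : Type*} [Ring A] [Algebra K A]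

/-- `D : A → B` is a derivation into the `A`-bimodule `B`. -/
def IsDerivation {B : Type*} [AddCommMonoid B] [Module K B] (SB : BimoduleStr K A B)
    (D : A →ₗ[K] B) : Prop :=
  ∀ a a', D (a * a') = SB.lact a (D a') + SB.ract a' (D a)

theorem IsDerivation.map_one {B : Type*} [AddCommGroup B] [Module K B] {SB : BimoduleStr K A B}
    {D : A →ₗ[K] B} (hD : IsDerivation SB D) : D 1 = 0 := by
  have h := hD 1 1
  rw [mul_one, SB.one_lact, SB.one_ract] at h
  simpa using h

theorem IsDerivation.comp {B C : Type*} [AddCommMonoid B] [Module K B] [AddCommMonoid C]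
    [Module K C] {SB : BimoduleStr K A B} {SC : BimoduleStr K A C} {D : A →ₗ[K] B}
    (hD : IsDerivation SB D) {f : B →ₗ[K] C} (hf : IsBimoduleHom SB SC f) :
    IsDerivation SC (f ∘ₗ D) := fun a a' => by
  simp only [LinearMap.comp_apply, hD a a', map_add, hf.map_lact, hf.map_ract]

variable (K A) in
/-- The universal derivation `a ↦ 1 ⊗ a - a ⊗ 1`. -/
noncomputable def universalDerivation : A →ₗ[K] OmegaOne K A :=
  (TensorProduct.mk K A A 1 - (TensorProduct.mk K A A).flip 1).codRestrict _ fun a => by simp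

theorem coe_universalDerivation (a : A) :
    (universalDerivation K A a : A ⊗[K] A) = 1 ⊗ₜ a - a ⊗ₜ 1 := rfl

variable (K A) in
theorem isDerivation_universalDerivation :
    IsDerivation (omegaOneBimodule K A) (universalDerivation K A) := fun a a' => by
  refine Subtype.ext ?_
  change _ = (tensorSquareBimodule K A).lact a (1 ⊗ₜ a' - a' ⊗ₜ 1) +
    (tensorSquareBimodule K A).ract a' (1 ⊗ₜ a - a ⊗ₜ 1)
  simp [coe_universalDerivation]

/-- The linear map `Ω¹A → B`, `∑ x ⊗ y ↦ ∑ x D(y)`. -/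
noncomputable def omegaLift {B : Type*} [AddCommMonoid B] [Module K B] (SB : BimoduleStr K A B)
    (D : A →ₗ[K] B) : OmegaOne K A →ₗ[K] B :=
  (TensorProduct.lift SB.lact ∘ₗ D.lTensor A) ∘ₗ (OmegaOne K A).subtype

/-- Right linearity holds only on `Ω¹A`: on `A ⊗ A` the Leibniz rule leaves the extra term `(∑ x y)
D(a)`, which vanishes on the kernel of multiplication. -/
theorem isBimoduleHom_omegaLift {B : Type*} [AddCommGroup B] [Module K B]
    {SB : BimoduleStr K A B} {D : A →ₗ[K] B} (hD : IsDerivation SB D) :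
    IsBimoduleHom (omegaOneBimodule K A) SB (omegaLift SB D) where
  map_lact a w := by
    change (TensorProduct.lift SB.lact ∘ₗ D.lTensor A) ((tensorSquareBimodule K A).lact a w) =
      SB.lact a ((TensorProduct.lift SB.lact ∘ₗ D.lTensor A) w)
    generalize (w : A ⊗[K] A) = t
    induction t with
    | zero => simp
    | add x y hx hy => simp only [map_add, hx, hy]
    | tmul x y => simp [SB.mul_lact]
  map_ract a w := by
    have key : ∀ t : A ⊗[K] A,
        (TensorProduct.lift SB.lact ∘ₗ D.lTensor A) ((tensorSquareBimodule K A).ract a t) =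
        SB.lact (LinearMap.mul' K A t) (D a) +
          SB.ract a ((TensorProduct.lift SB.lact ∘ₗ D.lTensor A) t) := by
      intro t
      induction t with
      | zero => simp
      | add x y hx hy =>
        simp only [map_add, hx, hy, LinearMap.add_apply]
        abel
      | tmul x y => simp [SB.mul_lact, hD y a, SB.lact_ract]
    have h := key w
    rw [LinearMap.mem_ker.1 w.2, map_zero, LinearMap.zero_apply, zero_add] at h
    exact h

theorem omegaLift_universalDerivation {B : Type*} [AddCommGroup B] [Module K B]
    {SB : BimoduleStr K A B} {D : A →ₗ[K] B} (hD : IsDerivation SB D) :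
    omegaLift SB D ∘ₗ universalDerivation K A = D := by
  ext a
  simp [omegaLift, coe_universalDerivation, SB.one_lact, hD.map_one]

/-- The universal derivation generates `Ω¹A` as a left module: `∑ x (1 ⊗ y - y ⊗ 1) = t - (∑ x y) ⊗
1` for `t = ∑ x ⊗ y`, and this is `t` on the kernel. -/
theorem eq_omegaLift {B : Type*} [AddCommGroup B] [Module K B] {SB : BimoduleStr K A B}
    {g : OmegaOne K A →ₗ[K] B} (hg : IsBimoduleHom (omegaOneBimodule K A) SB g) :
    omegaLift SB (g ∘ₗ universalDerivation K A) = g := by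
  have key : ∀ t : A ⊗[K] A,
      (TensorProduct.lift SB.lact ∘ₗ (g ∘ₗ universalDerivation K A).lTensor A) t =
      g (TensorProduct.lift (omegaOneBimodule K A).lact ((universalDerivation K A).lTensor A t)) := by
    intro t
    induction t with
    | zero => simp
    | add x y hx hy => simp only [map_add, hx, hy]
    | tmul x y => simp [hg.map_lact]
  have key2 : ∀ t : A ⊗[K] A,
      ((TensorProduct.lift (omegaOneBimodule K A).lact ((universalDerivation K A).lTensor A t) :
        OmegaOne K A) : A ⊗[K] A) = t - LinearMap.mul' K A t ⊗ₜ 1 := by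
    intro t
    induction t with
    | zero => simp
    | add x y hx hy =>
      simp only [map_add, Submodule.coe_add, hx, hy, TensorProduct.add_tmul]
      abel
    | tmul x y =>
      simp only [LinearMap.lTensor_tmul, TensorProduct.lift.tmul]
      change (tensorSquareBimodule K A).lact x (1 ⊗ₜ y - y ⊗ₜ 1) = _
      simp
  ext w
  refine (key w).trans (congrArg g (Subtype.ext ?_))
  rw [key2, LinearMap.mem_ker.1 w.2, TensorProduct.zero_tmul, sub_zero]

theorem comp_omegaLift {B C : Type*} [AddCommMonoid B] [Module K B] [AddCommMonoid C]
    [Module K C] {SB : BimoduleStr K A B} {SC : BimoduleStr K A C} {f : B →ₗ[K] C}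
    (hf : IsBimoduleHom SB SC f) (D : A →ₗ[K] B) :
    f ∘ₗ omegaLift SB D = omegaLift SC (f ∘ₗ D) := by
  ext w
  simp only [omegaLift, LinearMap.comp_apply]
  generalize ((OmegaOne K A).subtype w) = t
  induction t with
  | zero => simp
  | add x y hx hy => simp only [map_add, hx, hy]
  | tmul x y => simp [hf.map_lact]

end Derivations

/-- Derivations of `A` lift along morphisms of bimodules that have a `K`-linear section. -/
def LiftsDerivations.{u, v} (K : Type u) [Field K] (A : Type v) [Ring A] [Algebra K A] : Prop :=
  ∀ (B C : Type v) [AddCommGroup B] [Module K B] [AddCommGroup C] [Module K C]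
    (SB : BimoduleStr K A B) (SC : BimoduleStr K A C) (f : B →ₗ[K] C),
    IsBimoduleHom SB SC f → (∃ s : C →ₗ[K] B, f ∘ₗ s = LinearMap.id) →
    ∀ D : A →ₗ[K] C, IsDerivation SC D → ∃ E : A →ₗ[K] B, IsDerivation SB E ∧ f ∘ₗ E = D

theorem isFormallySmoothAlg_iff_liftsDerivations (K : Type*) [Field K] (A : Type*) [Ring A]
    [Algebra K A] : IsFormallySmoothAlg K A ↔ LiftsDerivations K A := by
  constructor
  · intro h B C _ _ _ _ SB SC f hf hs D hD
    obtain ⟨l, hl, hfl⟩ := h B C SB SC f hf hs (omegaLift SC D) (isBimoduleHom_omegaLift hD)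
    refine ⟨l ∘ₗ universalDerivation K A, (isDerivation_universalDerivation K A).comp hl, ?_⟩
    rw [← LinearMap.comp_assoc, hfl, omegaLift_universalDerivation hD]
  · intro h B C _ _ _ _ SB SC f hf hs g hg
    obtain ⟨E, hE, hfE⟩ := h B C SB SC f hf hs (g ∘ₗ universalDerivation K A)
      ((isDerivation_universalDerivation K A).comp hg)
    refine ⟨omegaLift SB E, isBimoduleHom_omegaLift hE, ?_⟩
    rw [comp_omegaLift hf, hfE, eq_omegaLift hg]

/-! ### Derivations of the opposite algebra -/

section Opposite

variable {K : Type*} [Field K] {A : Type*} [Ring A] [Algebra K A]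

/-- A bimodule over the opposite algebra, seen as a bimodule with both actions exchanged. -/
def BimoduleStr.unop {B : Type*} [AddCommMonoid B] [Module K B] (SB : BimoduleStr K Aᵐᵒᵖ B) :
    BimoduleStr K A B where
  lact := SB.ract ∘ₗ (MulOpposite.opLinearEquiv K).toLinearMap
  ract := SB.lact ∘ₗ (MulOpposite.opLinearEquiv K).toLinearMap
  one_lact := SB.one_ract
  mul_lact a a' b := SB.mul_ract (MulOpposite.op a') (MulOpposite.op a) b
  one_ract := SB.one_lact
  mul_ract a a' b := SB.mul_lact (MulOpposite.op a') (MulOpposite.op a) b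
  lact_ract a a' b := (SB.lact_ract (MulOpposite.op a') (MulOpposite.op a) b).symm

theorem LiftsDerivations.op (h : LiftsDerivations K A) : LiftsDerivations K Aᵐᵒᵖ := by
  intro B C _ _ _ _ SB SC f hf hs D hD
  obtain ⟨E, hE, hfE⟩ := h B C SB.unop SC.unop f
    ⟨fun a => hf.map_ract (MulOpposite.op a), fun a => hf.map_lact (MulOpposite.op a)⟩ hs
    (D ∘ₗ (MulOpposite.opLinearEquiv K).toLinearMap)
    fun a a' => (hD (MulOpposite.op a') (MulOpposite.op a)).trans (add_comm _ _)
  refine ⟨E ∘ₗ (MulOpposite.opLinearEquiv K).symm.toLinearMap,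
    fun a a' => (hE a'.unop a.unop).trans (add_comm _ _), ?_⟩
  rw [← LinearMap.comp_assoc, hfE]
  rfl

end Opposite

/-! ### Formally smooth algebras are hereditary -/

section Hereditary

variable (K : Type*) [Field K] (A : Type*) [Ring A] [Algebra K A]

/-- The `A`-bimodule of `K`-linear maps between two left `A`-modules. -/
noncomputable def homBimodule (M X : Type*) [AddCommGroup M] [Module K M] [Module A M]
    [IsScalarTower K A M] [AddCommGroup X] [Module K X] [Module A X] [IsScalarTower K A X] :
    BimoduleStr K A (M →ₗ[K] X) where
  lact := LinearMap.mk₂ K (fun a f => Algebra.lsmul K K X a ∘ₗ f)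
    (fun a a' f => by ext; simp) (fun c a f => by ext; simp)
    (fun a f f' => by ext; simp) (fun c a f => by ext; simp [smul_comm a c])
  ract := LinearMap.mk₂ K (fun a f => f ∘ₗ Algebra.lsmul K K M a)
    (fun a a' f => by ext; simp) (fun c a f => by ext; simp)
    (fun a f f' => by ext; simp) (fun c a f => by ext; simp)
  one_lact f := by ext; simp
  mul_lact a a' f := by ext; simp
  one_ract f := by ext; simp
  mul_ract a a' f := by ext; simp
  lact_ract a a' f := by ext; simp

variable {K A} in
theorem homBimodule_lact_apply {M X : Type*} [AddCommGroup M] [Module K M] [Module A M]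
    [IsScalarTower K A M] [AddCommGroup X] [Module K X] [Module A X] [IsScalarTower K A X]
    (a : A) (f : M →ₗ[K] X) (m : M) : (homBimodule K A M X).lact a f m = a • f m := rfl

variable {K A} in
theorem homBimodule_ract_apply {M X : Type*} [AddCommGroup M] [Module K M] [Module A M]
    [IsScalarTower K A M] [AddCommGroup X] [Module K X] [Module A X] [IsScalarTower K A X]
    (a : A) (f : M →ₗ[K] X) (m : M) : (homBimodule K A M X).ract a f m = f (a • m) := rfl

/-- The action `A ⊗ M → M` as an `A`-linear map. -/
noncomputable def tensorAct (M : Type*) [AddCommGroup M] [Module K M] [Module A M]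
    [IsScalarTower K A M] : A ⊗[K] M →ₗ[A] M where
  toFun := TensorProduct.lift (Algebra.lsmul K K M).toLinearMap
  map_add' := map_add _
  map_smul' a t := by
    induction t with
    | zero => simp
    | add x y hx hy => simp only [smul_add, map_add, hx, hy]
    | tmul x y => simp [TensorProduct.smul_tmul']

variable {A} in
@[simp] theorem tensorAct_tmul {M : Type*} [AddCommGroup M] [Module K M] [Module A M]
    [IsScalarTower K A M] (a : A) (m : M) : tensorAct K A M (a ⊗ₜ m) = a • m := rfl

theorem tensorAct_surjective (M : Type*) [AddCommGroup M] [Module K M] [Module A M]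
    [IsScalarTower K A M] : Function.Surjective (tensorAct K A M) :=
  fun m => ⟨1 ⊗ₜ m, by simp⟩

variable {K A}

/-- The identity of `N` has a connecting class in `Ext¹(Q, N)`. It lifts to `Ext¹(Q, A ⊗ N)`, where
it comes from some `t : N → A ⊗ N` because `P` is projective. Then `id - μ t` has zero class, so it
extends to `u : P → N`, which lifts through `μ`; correcting `t` by this lift splits `μ`. The
argument is carried out with explicit cocycles. -/
theorem LiftsDerivations.projective_of_exact.{u, v} {K : Type u} [Field K] {A : Type v} [Ring A]
    [Algebra K A] (hA : LiftsDerivations K A) {N P Q : Type v}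
    [AddCommGroup P] [Module K P] [Module A P] [IsScalarTower K A P] [Module.Projective A P]
    [AddCommGroup N] [Module K N] [Module A N] [IsScalarTower K A N]
    [AddCommGroup Q] [Module K Q] [Module A Q] [IsScalarTower K A Q]
    (ι : N →ₗ[A] P) (π : P →ₗ[A] Q) (hι : Function.Injective ι) (hπ : Function.Surjective π)
    (hex : Function.Exact ι π) : Module.Projective A N := by
  obtain ⟨j, hj⟩ := LinearMap.exists_rightInverse_of_surjective (π.restrictScalars K)
    (LinearMap.range_eq_top.2 hπ)
  replace hj : ∀ m, π (j m) = m := LinearMap.congr_fun hj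
  have hr : ∀ p, ∃ n, ι n = p - j (π p) := fun p => (hex _).1 (by rw [map_sub, hj, sub_self])
  obtain ⟨r, hr⟩ : ∃ r : P →ₗ[K] N, ∀ p, ι (r p) = p - j (π p) := by
    choose r hr using hr
    refine ⟨⟨⟨r, fun p q => hι ?_⟩, fun c p => hι ?_⟩, hr⟩
    · rw [map_add, hr, hr, hr, map_add, map_add]
      abel
    · simp only [RingHom.id_apply, LinearMap.map_smul_of_tower, hr, smul_sub]
  have hrsmul : ∀ (a : A) p, r (a • p) = a • r p + r (a • j (π p)) := fun a p => hι (by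
    simp only [map_add, map_smul, hr, hj, smul_sub]
    abel)
  -- The extension cocycle: `r` fails to be `A`-linear exactly by `D a (π p)`.
  let D : A →ₗ[K] (Q →ₗ[K] N) :=
    LinearMap.llcomp K Q _ _ r ∘ₗ j.lcomp K _ ∘ₗ (Algebra.lsmul K K P).toLinearMap
  have hDv : ∀ a m, D a m = r (a • j m) := fun a m => rfl
  have hD : IsDerivation (homBimodule K A Q N) D := by
    intro a a'
    ext m
    rw [LinearMap.add_apply, homBimodule_lact_apply, homBimodule_ract_apply]
    simp only [hDv, mul_smul]
    rw [hrsmul, map_smul π, hj]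
  obtain ⟨μ, hμ⟩ : ∃ μ : A ⊗[K] N →ₗ[A] N, Function.Surjective μ :=
    ⟨tensorAct K A N, tensorAct_surjective K A N⟩
  obtain ⟨s, hs⟩ := LinearMap.exists_rightInverse_of_surjective (μ.restrictScalars K)
    (LinearMap.range_eq_top.2 hμ)
  obtain ⟨E, hE, hfE⟩ := hA (Q →ₗ[K] A ⊗[K] N) (Q →ₗ[K] N)
    (homBimodule K A Q (A ⊗[K] N)) (homBimodule K A Q N)
    (LinearMap.llcomp K Q _ _ (μ.restrictScalars K))
    ⟨fun a f => LinearMap.ext fun m => μ.map_smul a (f m), fun a f => rfl⟩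
    ⟨LinearMap.llcomp K Q _ _ s, LinearMap.ext fun f => LinearMap.ext fun m =>
      LinearMap.congr_fun hs (f m)⟩ D hD
  replace hfE : ∀ a m, μ (E a m) = D a m := fun a m =>
    LinearMap.congr_fun (LinearMap.congr_fun hfE a) m
  replace hE : ∀ a a' m, E (a * a') m = a • E a' m + E a (a' • m) := fun a a' m =>
    LinearMap.congr_fun (hE a a') m
  obtain ⟨σ, hσ⟩ := Module.projective_lifting_property (tensorAct K A P) LinearMap.id
    (tensorAct_surjective K A P)
  replace hσ : ∀ p, tensorAct K A P (σ p) = p := LinearMap.congr_fun hσ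
  -- `a ⊗ p ↦ E a (π p)`. Composed with the `A`-linear splitting `σ`, it trivializes the cocycle `E`
  -- after pullback to `P`.
  let ev : A ⊗[K] P →ₗ[K] A ⊗[K] N := TensorProduct.lift (E.compl₂ (π.restrictScalars K))
  have hev : ∀ a w, ev (a • w) = a • ev w + E a (π (tensorAct K A P w)) := by
    intro a w
    induction w with
    | zero => simp
    | add x y hx hy =>
      simp only [smul_add, map_add, hx, hy]
      abel
    | tmul x y => simp [ev, TensorProduct.smul_tmul', hE]
  have ht : ∀ a p, ev (σ (a • p)) = a • ev (σ p) + E a (π p) := fun a p => by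
    rw [map_smul, hev, hσ]
  -- Both `r` and `μ ∘ ev ∘ σ` have defect of linearity `D a (π p)`, so their difference is
  -- `A`-linear.
  let u : P →ₗ[A] N :=
    { toFun := fun p => r p - μ (ev (σ p))
      map_add' := fun p q => by
        simp only [map_add]
        abel
      map_smul' := fun a p => by
        rw [RingHom.id_apply, ht, map_add, hfE, hDv, hrsmul a p, smul_sub, map_smul μ]
        abel }
  obtain ⟨v, hv⟩ := Module.projective_lifting_property μ u hμ
  have hπι : ∀ n, π (ι n) = 0 := hex.apply_apply_eq_zero
  -- On `N` the defect of `ev ∘ σ` disappears, since `π ∘ ι = 0`.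
  let t : N →ₗ[A] A ⊗[K] N :=
    { toFun := fun n => ev (σ (ι n))
      map_add' := fun n n' => by simp only [map_add]
      map_smul' := fun a n => by
        rw [map_smul, ht, hπι, map_zero, add_zero, RingHom.id_apply] }
  refine Module.Projective.of_split (M := A ⊗[K] N) (v ∘ₗ ι + t) μ (LinearMap.ext fun n => ?_)
  have h1 : μ (v (ι n)) = u (ι n) := LinearMap.congr_fun hv (ι n)
  change μ (v (ι n) + ev (σ (ι n))) = n
  rw [map_add, h1]
  change r (ι n) - μ (ev (σ (ι n))) + μ (ev (σ (ι n))) = n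
  rw [sub_add_cancel]
  exact hι (by rw [hr, hπι, map_zero, sub_zero])

theorem LiftsDerivations.isLeftHereditary.{u, v} {K : Type u} [Field K] {A : Type v} [Ring A]
    [Algebra K A] (hA : LiftsDerivations K A) : IsLeftHereditary A := by
  intro P _ _ hP N
  let _ : Module K P := Module.compHom P (algebraMap K A)
  have : IsScalarTower K A P := ⟨fun c a p => by
    rw [Algebra.smul_def, mul_smul]
    rfl⟩
  exact hA.projective_of_exact N.subtype N.mkQ N.injective_subtype N.mkQ_surjective
    (LinearMap.exact_subtype_mkQ N)

end Hereditary

/-! ### Colinear derivations and formal smoothness in the category of comodules -/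

section ColinearDerivations

variable {K : Type*} [Field K] {H : Type*} [Ring H] [HopfAlgebra K H]

theorem IsColinear.apply {V W : Type*} [AddCommMonoid V] [Module K V] [AddCommMonoid W]
    [Module K W] {RV : RightComoduleStr K H V} {RW : RightComoduleStr K H W} {f : V →ₗ[K] W}
    (hf : IsColinear RV RW f) (v : V) : RW.coact (f v) = f.rTensor H (RV.coact v) :=
  LinearMap.congr_fun hf v

theorem IsColinear.comp {V W X : Type*} [AddCommMonoid V] [Module K V] [AddCommMonoid W]
    [Module K W] [AddCommMonoid X] [Module K X] {RV : RightComoduleStr K H V}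
    {RW : RightComoduleStr K H W} {RX : RightComoduleStr K H X} {g : W →ₗ[K] X} {f : V →ₗ[K] W}
    (hg : IsColinear RW RX g) (hf : IsColinear RV RW f) : IsColinear RV RX (g ∘ₗ f) :=
  LinearMap.ext fun v => by
    simp only [LinearMap.comp_apply, hg.apply, hf.apply, LinearMap.rTensor_comp]

theorem IsColinear.lTensor {V W X : Type*} [AddCommMonoid V] [Module K V] [AddCommMonoid W]
    [Module K W] [AddCommMonoid X] [Module K X] {RW : RightComoduleStr K H W}
    {RX : RightComoduleStr K H X} {f : W →ₗ[K] X} (RV : RightComoduleStr K H V)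
    (hf : IsColinear RW RX f) :
    IsColinear (RV.tensor RW) (RV.tensor RX) (f.lTensor V) := by
  refine TensorProduct.ext' fun v w => ?_
  simp only [RightComoduleStr.tensor, codiag, LinearMap.comp_apply, LinearMap.lTensor_tmul,
    TensorProduct.map_tmul, LinearEquiv.coe_coe, hf.apply]
  generalize RV.coact v = p
  generalize RW.coact w = q
  induction p with
  | zero => simp
  | add x y hx hy => simp only [TensorProduct.add_tmul, map_add, hx, hy]
  | tmul a b =>
    induction q with
    | zero => simp
    | add x y hx hy => simp only [TensorProduct.tmul_add, map_add, hx, hy]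
    | tmul c d => simp

variable {A : Type*} [Ring A] [Algebra K A] {RA : RightComoduleStr K H A}

theorem isColinear_omegaOne_subtype (hA : IsComoduleAlgebra RA) :
    IsColinear (omegaOneComodule RA hA) (RA.tensor RA) (OmegaOne K A).subtype :=
  (rTensor_kerCoact _ _ _ hA.colinear_mul).symm

/-- The coaction on `Ω¹A` is known through its injection into `A ⊗ A`; there the claim reduces to
coinvariance of the unit. -/
theorem isColinear_universalDerivation (hA : IsComoduleAlgebra RA) :
    IsColinear RA (omegaOneComodule RA hA) (universalDerivation K A) := by
  refine LinearMap.ext fun a => rTensor_subtype_injective (OmegaOne K A) H ?_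
  rw [LinearMap.comp_apply, ← (isColinear_omegaOne_subtype hA).apply, Submodule.subtype_apply,
    coe_universalDerivation]
  simp only [RightComoduleStr.tensor, codiag, LinearMap.comp_apply, map_sub,
    TensorProduct.map_tmul, LinearEquiv.coe_coe, hA.coact_one]
  generalize RA.coact a = p
  induction p with
  | zero => simp
  | add x y hx hy =>
    simp only [TensorProduct.tmul_add, TensorProduct.add_tmul, map_add, ← hx, ← hy]
    abel
  | tmul b c => simp [coe_universalDerivation, TensorProduct.sub_tmul]

theorem isColinear_omegaLift (hA : IsComoduleAlgebra RA) {B : Type*} [AddCommGroup B]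
    [Module K B] {SB : BimoduleStr K A B} {RB : RightComoduleStr K H B}
    (hB : IsComoduleBimodule RA SB RB) {D : A →ₗ[K] B} (hD : IsColinear RA RB D) :
    IsColinear (omegaOneComodule RA hA) RB (omegaLift SB D) :=
  (hB.colinear_lact.comp (hD.lTensor RA)).comp (isColinear_omegaOne_subtype hA)

end ColinearDerivations

/-- Colinear derivations of `A` lift along morphisms of bimodules in right comodules that have a
colinear section. -/
def LiftsColinearDerivations.{u, w, v} {K : Type u} [Field K] {H : Type w} [Ring H]
    [HopfAlgebra K H] {A : Type v} [Ring A] [Algebra K A] (RA : RightComoduleStr K H A) : Prop :=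
  ∀ (B C : Type v) [AddCommGroup B] [Module K B] [AddCommGroup C] [Module K C]
    (SB : BimoduleStr K A B) (RB : RightComoduleStr K H B)
    (SC : BimoduleStr K A C) (RC : RightComoduleStr K H C),
    IsComoduleBimodule RA SB RB → IsComoduleBimodule RA SC RC →
    ∀ f : B →ₗ[K] C, IsBimoduleHom SB SC f → IsColinear RB RC f →
    (∃ s : C →ₗ[K] B, IsColinear RC RB s ∧ f ∘ₗ s = LinearMap.id) →
    ∀ D : A →ₗ[K] C, IsDerivation SC D → IsColinear RA RC D →
      ∃ E : A →ₗ[K] B, IsDerivation SB E ∧ IsColinear RA RB E ∧ f ∘ₗ E = D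

theorem isFormallySmoothComoduleAlg_iff_liftsColinearDerivations {K : Type*} [Field K]
    {H : Type*} [Ring H] [HopfAlgebra K H] {A : Type*} [Ring A] [Algebra K A]
    (RA : RightComoduleStr K H A) (hA : IsComoduleAlgebra RA) :
    IsFormallySmoothComoduleAlg RA hA ↔ LiftsColinearDerivations RA := by
  constructor
  · intro h B C _ _ _ _ SB RB SC RC hB hC f hf hfc hs D hD hDc
    obtain ⟨l, hl, hlc, hfl⟩ := h B C SB RB SC RC hB hC f hf hfc hs (omegaLift SC D)
      (isBimoduleHom_omegaLift hD) (isColinear_omegaLift hA hC hDc)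
    refine ⟨l ∘ₗ universalDerivation K A, (isDerivation_universalDerivation K A).comp hl,
      hlc.comp (isColinear_universalDerivation hA), ?_⟩
    rw [← LinearMap.comp_assoc, hfl, omegaLift_universalDerivation hD]
  · intro h B C _ _ _ _ SB RB SC RC hB hC f hf hfc hs g hg hgc
    obtain ⟨E, hE, hEc, hfE⟩ := h B C SB RB SC RC hB hC f hf hfc hs (g ∘ₗ universalDerivation K A)
      ((isDerivation_universalDerivation K A).comp hg)
      (hgc.comp (isColinear_universalDerivation hA))
    refine ⟨omegaLift SB E, isBimoduleHom_omegaLift hE, isColinear_omegaLift hA hB hEc, ?_⟩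
    rw [comp_omegaLift hf, hfE, eq_omegaLift hg]

/-! ### Convolution with values in a right module -/

section RightConvolution

variable {K : Type*} [Field K]

/-- The convolution `c ↦ φ(c₁) ψ(c₂)` of `φ : C → M` and `ψ : C → R`, for a right action `r` of `R`
on `M`. -/
noncomputable def rightConv {R M C : Type*} [Ring R] [Algebra K R] [AddCommGroup M] [Module K M]
    [AddCommGroup C] [Module K C] [Coalgebra K C] (r : R →ₗ[K] M →ₗ[K] M) (φ : C →ₗ[K] M)
    (ψ : C →ₗ[K] R) : C →ₗ[K] M :=
  TensorProduct.lift (r.flip.compl₁₂ φ ψ) ∘ₗ Coalgebra.comul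

variable {R M C : Type*} [Ring R] [Algebra K R] [AddCommGroup M] [Module K M]
  [AddCommGroup C] [Module K C] [Coalgebra K C] {r : R →ₗ[K] M →ₗ[K] M}

theorem rightConv_eq_sum {ι : Type*} {c : C} (𝓡 : Coalgebra.Repr K c ι) (φ : C →ₗ[K] M)
    (ψ : C →ₗ[K] R) :
    rightConv r φ ψ c = ∑ i ∈ 𝓡.index, r (ψ (𝓡.right i)) (φ (𝓡.left i)) := by
  simp [rightConv, ← 𝓡.eq]

/-- By coassociativity, `Hom(C, M)` is a right module over the convolution algebra `Hom(C, R)`;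
convolution inverses in the latter can thus be cancelled. -/
theorem rightConv_rightConv (hr : ∀ a b m, r (a * b) m = r b (r a m)) (φ : C →ₗ[K] M)
    (ψ χ : C →ₗ[K] R) :
    rightConv r (rightConv r φ ψ) χ =
      rightConv r φ (WithConv.toConv ψ * WithConv.toConv χ).ofConv := by
  have key : ∀ t : C ⊗[K] C,
      TensorProduct.lift (r.flip.compl₁₂ (rightConv r φ ψ) χ) t =
      TensorProduct.lift (r.flip.compl₁₂ φ (LinearMap.mul' K R ∘ₗ TensorProduct.map ψ χ))
        (TensorProduct.assoc K C C C ((Coalgebra.comul (R := K)).rTensor C t)) := by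
    intro t
    induction t with
    | zero => simp
    | add x y hx hy => simp only [map_add, hx, hy]
    | tmul a b =>
      simp only [rightConv, TensorProduct.lift.tmul, LinearMap.compl₁₂_apply,
        LinearMap.flip_apply, LinearMap.comp_apply, LinearMap.rTensor_tmul]
      generalize Coalgebra.comul (R := K) a = p
      induction p with
      | zero => simp
      | add x y hx hy => simp only [map_add, TensorProduct.add_tmul, hx, hy]
      | tmul x y => simp [hr]
  ext c
  change TensorProduct.lift (r.flip.compl₁₂ (rightConv r φ ψ) χ) (Coalgebra.comul c) =
    TensorProduct.lift (r.flip.compl₁₂ φ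
      (LinearMap.mul' K R ∘ₗ TensorProduct.map ψ χ ∘ₗ Coalgebra.comul)) (Coalgebra.comul c)
  rw [key, Coalgebra.coassoc_apply]
  generalize Coalgebra.comul (R := K) c = p
  induction p with
  | zero => simp
  | add x y hx hy => simp only [map_add, hx, hy]
  | tmul x y => simp

theorem rightConv_one (hr : ∀ m, r 1 m = m) (φ : C →ₗ[K] M) :
    rightConv r φ (1 : WithConv (C →ₗ[K] R)).ofConv = φ := by
  ext c
  have h := congrArg (φ ∘ₗ (TensorProduct.rid K C).toLinearMap)
    (Coalgebra.sum_tmul_counit_eq (Coalgebra.Repr.arbitrary K c))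
  simp only [map_sum, LinearMap.comp_apply, LinearEquiv.coe_coe, TensorProduct.rid_tmul, map_smul,
    one_smul] at h
  rw [rightConv_eq_sum (Coalgebra.Repr.arbitrary K c)]
  simpa [LinearMap.convOne_def, Algebra.algebraMap_eq_smul_one, hr] using h

end RightConvolution

/-! ### The adjoint action and lifting along an `fs`-section -/

section AdjointAction

open Coalgebra (comul counit)
open HopfAlgebra (antipode)

variable {K : Type*} [Field K] {H : Type*} [Ring H] [HopfAlgebra K H]

theorem rightConv_mul_eq_sum {R M : Type*} [Ring R] [Algebra K R] [AddCommGroup M] [Module K M]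
    (r : R →ₗ[K] M →ₗ[K] M) {ι κ : Type*} {h k : H} (𝓡 : Coalgebra.Repr K h ι)
    (𝓢 : Coalgebra.Repr K k κ) (φ : H →ₗ[K] M) (ψ : H →ₗ[K] R) :
    rightConv r φ ψ (h * k) = ∑ i ∈ 𝓡.index, ∑ j ∈ 𝓢.index,
      r (ψ (𝓡.right i * 𝓢.right j)) (φ (𝓡.left i * 𝓢.left j)) := by
  rw [rightConv_eq_sum (𝓡.mul 𝓢)]
  simp [Finset.sum_product]

section

variable {B : Type*} [AddCommGroup B] [Module K B] (SB : BimoduleStr K H B)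

/-- The left adjoint action `h ▹ b = h₁ b S(h₂)` on an `H`-bimodule, as `b ↦ h ↦ h ▹ b`. -/
noncomputable def adjointAct : B →ₗ[K] H →ₗ[K] B where
  toFun b := rightConv SB.ract (SB.lact.flip b) (antipode K)
  map_add' b b' := by
    ext h
    simp [rightConv_eq_sum (Coalgebra.Repr.arbitrary K h), Finset.sum_add_distrib]
  map_smul' c b := by
    ext h
    simp [rightConv_eq_sum (Coalgebra.Repr.arbitrary K h), Finset.smul_sum]

theorem adjointAct_eq_sum {ι : Type*} {h : H} (𝓡 : Coalgebra.Repr K h ι) (b : B) :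
    adjointAct SB b h =
      ∑ i ∈ 𝓡.index, SB.ract (antipode K (𝓡.right i)) (SB.lact (𝓡.left i) b) :=
  rightConv_eq_sum 𝓡 _ _

/-- The antipode and the identity are convolution inverses; this recovers a derivation from its
cocycle. -/
theorem rightConv_antipode_id (φ : H →ₗ[K] B) :
    rightConv SB.ract (rightConv SB.ract φ (antipode K)) LinearMap.id = φ := by
  rw [rightConv_rightConv SB.mul_ract, LinearMap.antipode_mul_id, rightConv_one SB.one_ract]

theorem rightConv_adjointAct_id (b : B) :
    rightConv SB.ract (adjointAct SB b) LinearMap.id = SB.lact.flip b :=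
  rightConv_antipode_id SB _

theorem adjointAct_mul (b : B) (h k : H) :
    adjointAct SB b (h * k) = adjointAct SB (adjointAct SB b k) h := by
  rw [adjointAct_eq_sum SB ((Coalgebra.Repr.arbitrary K h).mul (Coalgebra.Repr.arbitrary K k)),
    adjointAct_eq_sum SB (Coalgebra.Repr.arbitrary K h),
    adjointAct_eq_sum SB (Coalgebra.Repr.arbitrary K k)]
  simp [Finset.sum_product, HopfAlgebra.antipode_mul_antidistrib, SB.mul_ract, SB.mul_lact,
    SB.lact_ract]

/-- A map `φ` satisfying the `1`-cocycle identity for the adjoint action gives the derivation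
`h ↦ φ(h₁) h₂`. -/
theorem isDerivation_rightConv_id {φ : H →ₗ[K] B}
    (hφ : ∀ h k, φ (h * k) = adjointAct SB (φ k) h + counit (R := K) k • φ h) :
    IsDerivation SB (rightConv SB.ract φ LinearMap.id) := by
  intro h k
  -- `(h₁ ▹ b) h₂ = h b`: this turns the adjoint term of the cocycle identity into the left term of
  -- the Leibniz rule.
  have h1 : ∀ b, ∑ i ∈ (Coalgebra.Repr.arbitrary K h).index,
      SB.ract ((Coalgebra.Repr.arbitrary K h).right i)
        (adjointAct SB b ((Coalgebra.Repr.arbitrary K h).left i)) = SB.lact h b := fun b =>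
    (rightConv_eq_sum _ _ _).symm.trans (LinearMap.congr_fun (rightConv_adjointAct_id SB b) h)
  have h2 : ∀ b, ∑ j ∈ (Coalgebra.Repr.arbitrary K k).index,
      counit (R := K) ((Coalgebra.Repr.arbitrary K k).left j) •
        SB.ract ((Coalgebra.Repr.arbitrary K k).right j) b = SB.ract k b := fun b => by
    conv_rhs => rw [← Coalgebra.sum_counit_smul (Coalgebra.Repr.arbitrary K k)]
    simp
  rw [rightConv_mul_eq_sum _ (Coalgebra.Repr.arbitrary K h) (Coalgebra.Repr.arbitrary K k),
    rightConv_eq_sum (Coalgebra.Repr.arbitrary K h),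
    rightConv_eq_sum (Coalgebra.Repr.arbitrary K k), map_sum, ← h2, Finset.sum_comm,
    ← Finset.sum_add_distrib]
  refine Finset.sum_congr rfl fun j _ => ?_
  simp only [LinearMap.id_apply, hφ, SB.mul_ract, map_add, map_smul, Finset.sum_add_distrib]
  rw [← map_sum, h1, ← Finset.smul_sum, ← map_sum, SB.lact_ract]

/-- For a derivation `D`, the map `h ↦ D(h₁) S(h₂)` is a `1`-cocycle for the adjoint action. -/
theorem IsDerivation.rightConv_antipode_mul {SB : BimoduleStr K H B} {D : H →ₗ[K] B}
    (hD : IsDerivation SB D) (h k : H) :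
    rightConv SB.ract D (antipode K) (h * k) =
      adjointAct SB (rightConv SB.ract D (antipode K) k) h +
        counit (R := K) k • rightConv SB.ract D (antipode K) h := by
  -- `b k₁ S(k₂) = ε(k) b`, which collapses the right term of the Leibniz rule.
  have h2 : ∀ b, ∑ j ∈ (Coalgebra.Repr.arbitrary K k).index,
      SB.ract (antipode K ((Coalgebra.Repr.arbitrary K k).right j))
        (SB.ract ((Coalgebra.Repr.arbitrary K k).left j) b) = counit (R := K) k • b := fun b => by
    simp only [← SB.mul_ract, ← LinearMap.sum_apply, ← map_sum,
      HopfAlgebra.sum_mul_antipode_eq_smul, map_smul, LinearMap.smul_apply, SB.one_ract]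
  rw [rightConv_mul_eq_sum _ (Coalgebra.Repr.arbitrary K h) (Coalgebra.Repr.arbitrary K k),
    adjointAct_eq_sum SB (Coalgebra.Repr.arbitrary K h),
    rightConv_eq_sum (Coalgebra.Repr.arbitrary K h),
    rightConv_eq_sum (Coalgebra.Repr.arbitrary K k), Finset.smul_sum,
    ← Finset.sum_add_distrib]
  refine Finset.sum_congr rfl fun i _ => ?_
  simp only [hD ((Coalgebra.Repr.arbitrary K h).left i), SB.mul_ract, map_add,
    Finset.sum_add_distrib, HopfAlgebra.antipode_mul_antidistrib, map_sum, SB.lact_ract]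
  simp only [← map_sum, h2, map_smul]

theorem IsBimoduleHom.map_adjointAct {C : Type*} [AddCommGroup C] [Module K C]
    {SB : BimoduleStr K H B} {SC : BimoduleStr K H C} {f : B →ₗ[K] C}
    (hf : IsBimoduleHom SB SC f) (b : B) (h : H) :
    f (adjointAct SB b h) = adjointAct SC (f b) h := by
  simp [adjointAct_eq_sum _ (Coalgebra.Repr.arbitrary K h), hf.map_ract, hf.map_lact]

theorem IsBimoduleHom.map_rightConv {C : Type*} [AddCommGroup C] [Module K C]
    {SB : BimoduleStr K H B} {SC : BimoduleStr K H C} {f : B →ₗ[K] C}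
    (hf : IsBimoduleHom SB SC f) (φ : H →ₗ[K] B) (ψ : H →ₗ[K] H) :
    f ∘ₗ rightConv SB.ract φ ψ = rightConv SC.ract (f ∘ₗ φ) ψ := by
  ext h
  simp [rightConv_eq_sum (Coalgebra.Repr.arbitrary K h), hf.map_ract]

end

/-! ### Coinvariants -/

section Coinvariants

variable {B : Type*} [AddCommGroup B] [Module K B] {SB : BimoduleStr K H B}
  {RB : RightComoduleStr K H B}

theorem IsComoduleBimodule.coact_lact (hB : IsComoduleBimodule (regularComodule K H) SB RB)
    (h : H) (b : B) : RB.coact (SB.lact h b) =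
      TensorProduct.map₂ SB.lact (LinearMap.mul K H) (comul (R := K) h) (RB.coact b) := by
  have := hB.colinear_lact.apply (h ⊗ₜ b)
  rw [TensorProduct.lift.tmul] at this
  rw [this]
  simp only [RightComoduleStr.tensor, codiag, LinearMap.comp_apply, TensorProduct.map_tmul,
    LinearEquiv.coe_coe, regularComodule]
  generalize comul (R := K) h = p
  generalize RB.coact b = q
  induction p with
  | zero => simp
  | add x y hx hy => simp only [map_add, TensorProduct.add_tmul, hx, hy, LinearMap.add_apply]
  | tmul a b =>
    induction q with
    | zero => simp
    | add x y hx hy => simp only [map_add, TensorProduct.tmul_add, hx, hy]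
    | tmul c d => simp

theorem IsComoduleBimodule.coact_ract (hB : IsComoduleBimodule (regularComodule K H) SB RB)
    (h : H) (b : B) : RB.coact (SB.ract h b) =
      TensorProduct.map₂ SB.ract (LinearMap.mul K H).flip (comul (R := K) h) (RB.coact b) := by
  have := hB.colinear_ract.apply (b ⊗ₜ h)
  rw [TensorProduct.lift.tmul, LinearMap.flip_apply] at this
  rw [this]
  simp only [RightComoduleStr.tensor, codiag, LinearMap.comp_apply, TensorProduct.map_tmul,
    LinearEquiv.coe_coe, regularComodule]
  generalize comul (R := K) h = p
  generalize RB.coact b = q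
  induction p with
  | zero => simp
  | add x y hx hy => simp only [map_add, TensorProduct.tmul_add, hx, hy, LinearMap.add_apply]
  | tmul a b =>
    induction q with
    | zero => simp
    | add x y hx hy => simp only [map_add, TensorProduct.add_tmul, hx, hy]
    | tmul c d => simp

variable (SB) in
-- Coassociativity: both sides are `φ(h₁) h₂ ⊗ h₃`.
theorem rightConv_tmul_one_comul (φ : H →ₗ[K] B) :
    rightConv (TensorProduct.map₂ SB.ract (LinearMap.mul K H).flip)
        ((TensorProduct.mk K B H).flip 1 ∘ₗ φ) (comul (R := K)) =
      (rightConv SB.ract φ LinearMap.id).rTensor H ∘ₗ comul := by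
  have key : ∀ t : H ⊗[K] H, (rightConv SB.ract φ LinearMap.id).rTensor H t =
      TensorProduct.lift ((TensorProduct.map₂ SB.ract (LinearMap.mul K H).flip).flip.compl₁₂
        ((TensorProduct.mk K B H).flip 1 ∘ₗ φ) LinearMap.id)
          (TensorProduct.assoc K H H H ((comul (R := K)).rTensor H t)) := by
    intro t
    induction t with
    | zero => simp
    | add x y hx hy => simp only [map_add, hx, hy]
    | tmul a b =>
      simp only [LinearMap.rTensor_tmul, rightConv, LinearMap.comp_apply]
      generalize comul (R := K) a = p
      induction p with
      | zero => simp
      | add x y hx hy => simp only [map_add, TensorProduct.add_tmul, hx, hy]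
      | tmul x y => simp
  ext h
  rw [LinearMap.comp_apply, key, Coalgebra.coassoc_apply]
  simp only [rightConv, LinearMap.comp_apply]
  generalize comul (R := K) h = p
  induction p with
  | zero => simp
  | add x y hx hy => simp only [map_add, hx, hy]
  | tmul x y => simp

/-- Let `H ⊗ H` act on `B ⊗ H` from the right. Colinearity of `h ↦ φ(h₁) h₂` says that `ρ ∘ φ` and
`φ(-) ⊗ 1` agree after convolution with the comultiplication, where `ρ` is the coaction; this
convolution can be cancelled, with inverse `Δ ∘ S`. -/
theorem coact_eq_tmul_one (hB : IsComoduleBimodule (regularComodule K H) SB RB)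
    {φ : H →ₗ[K] B}
    (hφ : IsColinear (regularComodule K H) RB (rightConv SB.ract φ LinearMap.id)) (h : H) :
    RB.coact (φ h) = φ h ⊗ₜ 1 := by
  set r := TensorProduct.map₂ SB.ract (LinearMap.mul K H).flip with hr
  have hr1 : ∀ m, r 1 m = m := by
    intro m
    rw [Algebra.TensorProduct.one_def]
    induction m with
    | zero => simp
    | add x y hx hy => rw [map_add, hx, hy]
    | tmul x y => simp [hr, SB.one_ract]
  have hrm : ∀ s t m, r (s * t) m = r t (r s m) := by
    intro s t m
    induction m with
    | zero => simp
    | add x y hx hy => simp only [map_add, hx, hy]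
    | tmul x y =>
      induction s with
      | zero => simp
      | add s s' hs hs' => simp only [map_add, add_mul, LinearMap.add_apply, hs, hs']
      | tmul a b =>
        induction t with
        | zero => simp
        | add s s' hs hs' => simp only [map_add, mul_add, LinearMap.add_apply, hs, hs']
        | tmul c d => simp [hr, SB.mul_ract, mul_assoc]
  have h1 : rightConv r (RB.coact ∘ₗ φ) (comul (R := K)) =
      rightConv r ((TensorProduct.mk K B H).flip 1 ∘ₗ φ) (comul (R := K)) := by
    rw [hr, rightConv_tmul_one_comul]
    refine Eq.trans ?_ hφ
    ext h
    simp [rightConv_eq_sum (Coalgebra.Repr.arbitrary K h), hB.coact_ract]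
  have h2 := congrArg (fun X => rightConv r X (comul ∘ₗ antipode K (A := H))) h1
  simp only [rightConv_rightConv hrm, LinearMap.comul_right_inv, rightConv_one hr1] at h2
  exact LinearMap.congr_fun h2 h

/-- The cocycle `h ↦ h ▹ b` corresponds to `h ↦ h b`, which is colinear when `b` is coinvariant. -/
theorem coact_adjointAct (hB : IsComoduleBimodule (regularComodule K H) SB RB) {b : B}
    (hb : RB.coact b = b ⊗ₜ 1) (h : H) :
    RB.coact (adjointAct SB b h) = adjointAct SB b h ⊗ₜ 1 := by
  refine coact_eq_tmul_one hB ?_ h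
  rw [rightConv_adjointAct_id]
  refine LinearMap.ext fun h => ?_
  simp only [LinearMap.comp_apply, LinearMap.flip_apply, hB.coact_lact, hb, regularComodule]
  generalize comul (R := K) h = p
  induction p with
  | zero => simp
  | add x y hx hy => simp only [map_add, LinearMap.add_apply, hx, hy]
  | tmul x y => simp

theorem isColinear_rightConv_id (hB : IsComoduleBimodule (regularComodule K H) SB RB)
    {φ : H →ₗ[K] B} (hφ : ∀ h, RB.coact (φ h) = φ h ⊗ₜ 1) :
    IsColinear (regularComodule K H) RB (rightConv SB.ract φ LinearMap.id) := by
  refine Eq.trans ?_ (rightConv_tmul_one_comul SB φ)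
  ext h
  simp [rightConv_eq_sum (Coalgebra.Repr.arbitrary K h), hB.coact_ract, hφ]

end Coinvariants

variable (K H) in
/-- The projection `h ↦ h - ε(h)` of `H` onto its augmentation ideal. -/
noncomputable def augmentationProj : H →ₗ[K] augmentationIdeal K H where
  toFun h := ⟨h - algebraMap K H (counit h), by simp [RingHom.mem_ker]⟩
  map_add' h k := Subtype.ext (by simp; abel)
  map_smul' c h := Subtype.ext (by simp [Algebra.smul_def, mul_sub])

theorem coe_augmentationProj (h : H) :
    (augmentationProj K H h : H) = h - algebraMap K H (counit h) := rfl

/-- A cocycle identity for left multiplication with right action through `ε`; it feeds both the lift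
along `τ` and the construction of `τ`. -/
theorem augmentationProj_mul (h k : H) :
    augmentationProj K H (h * k) =
      h • augmentationProj K H k + counit (R := K) k • augmentationProj K H h := by
  ext
  simp only [coe_augmentationProj, Submodule.coe_add, Submodule.coe_smul, smul_eq_mul, mul_sub,
    Submodule.coe_smul_of_tower, smul_sub, Bialgebra.counit_mul, map_mul]
  simp only [Algebra.smul_def, ← Algebra.commutes (counit (R := K) k)]
  abel

theorem counit_coe_augmentationIdeal (x : augmentationIdeal K H) :
    counit (R := K) (x : H) = 0 := x.2

/-! ### Lifting derivations along an `fs`-section -/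

section Lift

variable {B C : Type*} [AddCommGroup B] [Module K B] [AddCommGroup C] [Module K C]

/-- The `1`-cocycle lifting `h ↦ D(h₁) S(h₂)` that is given by `τ` and a `K`-linear section `s`. -/
noncomputable def fsCocycle (τ : augmentationIdeal K H →ₗ[K] H ⊗[K] augmentationIdeal K H)
    (SB : BimoduleStr K H B) (SC : BimoduleStr K H C) (s : C →ₗ[K] B) (D : H →ₗ[K] C) :
    H →ₗ[K] B :=
  (TensorProduct.lift ((adjointAct SB).flip.compl₂ (s ∘ₗ rightConv SC.ract D (antipode K) ∘ₗ
    (augmentationIdeal K H).subtype.restrictScalars K)) ∘ₗ τ) ∘ₗ augmentationProj K H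

variable {τ : augmentationIdeal K H →ₗ[K] H ⊗[K] augmentationIdeal K H}
  {SB : BimoduleStr K H B} {SC : BimoduleStr K H C} {s : C →ₗ[K] B} {D : H →ₗ[K] C}

theorem IsFsSection.fsCocycle_mul (hτ : IsFsSection τ) (h k : H) :
    fsCocycle τ SB SC s D (h * k) = adjointAct SB (fsCocycle τ SB SC s D k) h +
      counit (R := K) k • fsCocycle τ SB SC s D h := by
  simp only [fsCocycle, LinearMap.comp_apply, augmentationProj_mul, map_add, _root_.map_smul,
    hτ.map_smul]
  congr 1
  generalize τ (augmentationProj K H k) = t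
  induction t with
  | zero => simp
  | add x y hx hy => simp only [smul_add, map_add, hx, hy, LinearMap.add_apply]
  | tmul x y => simp [TensorProduct.smul_tmul', adjointAct_mul]

/-- On `H⁺` the cocycle `φ` of `D` satisfies `a ▹ φ(b) = φ(a b)`, so `f` sends the lift at `x` to
`φ` of the product of `τ(x)`, that is, to `φ(x)`. Scalars do not matter because `φ(1) = 0`. -/
theorem IsFsSection.comp_fsCocycle (hτ : IsFsSection τ) {f : B →ₗ[K] C}
    (hf : IsBimoduleHom SB SC f) (hs : f ∘ₗ s = LinearMap.id) (hD : IsDerivation SC D) :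
    f ∘ₗ fsCocycle τ SB SC s D = rightConv SC.ract D (antipode K) := by
  have key : ∀ t : H ⊗[K] augmentationIdeal K H,
      f (TensorProduct.lift ((adjointAct SB).flip.compl₂ (s ∘ₗ rightConv SC.ract D (antipode K) ∘ₗ
        (augmentationIdeal K H).subtype.restrictScalars K)) t) =
      rightConv SC.ract D (antipode K) (augmentationAct K H t) := by
    intro t
    induction t with
    | zero => simp
    | add x y hx hy => simp only [map_add, Submodule.coe_add, hx, hy]
    | tmul x y =>
      have h1 : ∀ c, f (s c) = c := LinearMap.congr_fun hs
      simp [augmentationAct_tmul, hD.rightConv_antipode_mul, counit_coe_augmentationIdeal,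
        hf.map_adjointAct, h1]
  ext h
  have h1 : rightConv SC.ract D (antipode K) 1 = 0 := by
    simp [rightConv, Algebra.TensorProduct.one_def, hD.map_one]
  simp only [fsCocycle, LinearMap.comp_apply, key, hτ.mul_eq, coe_augmentationProj, map_sub,
    Algebra.algebraMap_eq_smul_one, _root_.map_smul, h1, smul_zero, sub_zero]

theorem coact_fsCocycle {RB : RightComoduleStr K H B} {RC : RightComoduleStr K H C}
    (hB : IsComoduleBimodule (regularComodule K H) SB RB)
    (hC : IsComoduleBimodule (regularComodule K H) SC RC) (hs : IsColinear RC RB s)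
    (hD : IsColinear (regularComodule K H) RC D) (h : H) :
    RB.coact (fsCocycle τ SB SC s D h) = fsCocycle τ SB SC s D h ⊗ₜ 1 := by
  have h1 : ∀ x, RB.coact (s (rightConv SC.ract D (antipode K) x)) =
      s (rightConv SC.ract D (antipode K) x) ⊗ₜ 1 := fun x => by
    rw [hs.apply, coact_eq_tmul_one hC (by rwa [rightConv_antipode_id]), LinearMap.rTensor_tmul]
  simp only [fsCocycle, LinearMap.comp_apply]
  generalize τ (augmentationProj K H h) = t
  induction t with
  | zero => simp
  | add x y hx hy => simp only [map_add, TensorProduct.add_tmul, hx, hy]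
  | tmul x y => exact coact_adjointAct hB (h1 _) x

theorem IsFsSection.liftsDerivations (hτ : IsFsSection τ) : LiftsDerivations K H := by
  rintro B C _ _ _ _ SB SC f hf ⟨s, hs⟩ D hD
  refine ⟨rightConv SB.ract (fsCocycle τ SB SC s D) LinearMap.id,
    isDerivation_rightConv_id SB hτ.fsCocycle_mul, ?_⟩
  rw [hf.map_rightConv, hτ.comp_fsCocycle hf hs hD, rightConv_antipode_id]

theorem IsFsSection.liftsColinearDerivations (hτ : IsFsSection τ) :
    LiftsColinearDerivations (regularComodule K H) := by
  rintro B C _ _ _ _ SB RB SC RC hB hC f hf _ ⟨s, hsc, hs⟩ D hD hDc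
  refine ⟨rightConv SB.ract (fsCocycle τ SB SC s D) LinearMap.id,
    isDerivation_rightConv_id SB hτ.fsCocycle_mul,
    isColinear_rightConv_id hB (coact_fsCocycle hB hC hsc hDc), ?_⟩
  rw [hf.map_rightConv, hτ.comp_fsCocycle hf hs hD, rightConv_antipode_id]

end Lift

end AdjointAction

/-! ### The bimodule `V ⊗ H` in right comodules, for a left `H`-module `V` -/

section HopfBimodule

open Coalgebra (comul counit)

variable (K : Type*) [Field K] (H : Type*) [Ring H] [HopfAlgebra K H]
variable (V : Type*) [AddCommGroup V] [Module K V] [Module H V] [IsScalarTower K H V]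

/-- The `H`-bimodule `V ⊗ H`, with `h (v ⊗ k) h' = h₁ v ⊗ h₂ k h'`. -/
noncomputable def hopfBimodule : BimoduleStr K H (V ⊗[K] H) where
  lact := TensorProduct.map₂ (Algebra.lsmul K K V).toLinearMap (LinearMap.mul K H) ∘ₗ comul
  ract := LinearMap.lTensorHom V ∘ₗ (LinearMap.mul K H).flip
  one_lact t := by
    induction t with
    | zero => simp
    | add x y hx hy => rw [map_add, hx, hy]
    | tmul x y => simp [Algebra.TensorProduct.one_def]
  mul_lact h k t := by
    simp only [LinearMap.comp_apply, Bialgebra.comul_mul]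
    generalize comul (R := K) h = p
    generalize comul (R := K) k = q
    induction t with
    | zero => simp
    | add x y hx hy => simp only [map_add, hx, hy]
    | tmul x y =>
      induction p with
      | zero => simp
      | add s s' hs hs' => simp only [map_add, add_mul, LinearMap.add_apply, hs, hs']
      | tmul a b =>
        induction q with
        | zero => simp
        | add s s' hs hs' => simp only [map_add, mul_add, LinearMap.add_apply, hs, hs']
        | tmul c d => simp [mul_assoc]
  one_ract t := by
    induction t with
    | zero => simp
    | add x y hx hy => rw [map_add, hx, hy]
    | tmul x y => simp
  mul_ract h k t := by
    induction t with
    | zero => simp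
    | add x y hx hy => simp only [map_add, hx, hy]
    | tmul x y => simp [mul_assoc]
  lact_ract h k t := by
    simp only [LinearMap.comp_apply]
    generalize comul (R := K) h = p
    induction t with
    | zero => simp
    | add x y hx hy => simp only [map_add, hx, hy]
    | tmul x y =>
      induction p with
      | zero => simp
      | add s s' hs hs' => simp only [map_add, LinearMap.add_apply, hs, hs']
      | tmul a b => simp [mul_assoc]

variable {K H V}

theorem hopfBimodule_lact (h : H) (t : V ⊗[K] H) : (hopfBimodule K H V).lact h t =
    TensorProduct.map₂ (Algebra.lsmul K K V).toLinearMap (LinearMap.mul K H)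
      (comul (R := K) h) t := rfl

theorem hopfBimodule_ract_tmul (h k : H) (v : V) :
    (hopfBimodule K H V).ract h (v ⊗ₜ k) = v ⊗ₜ (k * h) := rfl

end HopfBimodule

/-! ### The cofree coaction on `V ⊗ H` -/

section HopfComodule

open Coalgebra (comul counit)

variable (K : Type*) [Field K] (H : Type*) [Ring H] [HopfAlgebra K H]
variable (V : Type*) [AddCommGroup V] [Module K V]

/-- The right comodule `V ⊗ H`, with the coaction `v ⊗ h ↦ v ⊗ h₁ ⊗ h₂`. -/
noncomputable def cofreeComodule : RightComoduleStr K H (V ⊗[K] H) where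
  coact := (TensorProduct.assoc K V H H).symm.toLinearMap ∘ₗ (comul (R := K)).lTensor V
  coassoc := by
    refine TensorProduct.ext' fun v h => ?_
    have key : ∀ t : H ⊗[K] H, TensorProduct.assoc K (V ⊗[K] H) H H
        (((TensorProduct.assoc K V H H).symm.toLinearMap ∘ₗ
          (comul (R := K)).lTensor V).rTensor H ((TensorProduct.assoc K V H H).symm (v ⊗ₜ t))) =
        (TensorProduct.mk K V H v).rTensor (H ⊗[K] H)
          (TensorProduct.assoc K H H H ((comul (R := K)).rTensor H t)) := by
      intro t
      induction t with
      | zero => simp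
      | add x y hx hy => simp only [map_add, TensorProduct.tmul_add, hx, hy]
      | tmul a b =>
        simp only [TensorProduct.assoc_symm_tmul, LinearMap.rTensor_tmul, LinearMap.comp_apply,
          LinearMap.lTensor_tmul, LinearEquiv.coe_coe]
        generalize comul (R := K) a = p
        induction p with
        | zero => simp
        | add x y hx hy =>
          simp only [map_add, TensorProduct.add_tmul, TensorProduct.tmul_add, hx, hy]
        | tmul x y => simp
    change TensorProduct.assoc K (V ⊗[K] H) H H
        (((TensorProduct.assoc K V H H).symm.toLinearMap ∘ₗ
          (comul (R := K)).lTensor V).rTensor H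
            ((TensorProduct.assoc K V H H).symm (v ⊗ₜ comul h))) =
      (comul (R := K)).lTensor (V ⊗[K] H) ((TensorProduct.assoc K V H H).symm (v ⊗ₜ comul h))
    rw [key, Coalgebra.coassoc_apply]
    generalize comul (R := K) h = p
    induction p with
    | zero => simp
    | add x y hx hy => simp only [map_add, TensorProduct.tmul_add, hx, hy]
    | tmul x y => simp
  counit_coact := by
    refine TensorProduct.ext' fun v h => ?_
    conv_rhs => rw [LinearMap.id_apply, ← one_smul K h, ← TensorProduct.rid_tmul,
      ← Coalgebra.lTensor_counit_comul]
    simp only [LinearMap.comp_apply, LinearEquiv.coe_coe, LinearMap.lTensor_tmul]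
    generalize comul (R := K) h = p
    induction p with
    | zero => simp
    | add x y hx hy => simp only [map_add, TensorProduct.tmul_add, hx, hy]
    | tmul x y => simp

variable {K H V}

theorem cofreeComodule_coact_tmul (v : V) (h : H) : (cofreeComodule K H V).coact (v ⊗ₜ h) =
    (TensorProduct.mk K V H v).rTensor H (comul (R := K) h) := by
  simp only [cofreeComodule, LinearMap.comp_apply, LinearEquiv.coe_coe, LinearMap.lTensor_tmul]
  generalize comul (R := K) h = p
  induction p with
  | zero => simp
  | add x y hx hy => simp only [map_add, TensorProduct.tmul_add, hx, hy]
  | tmul x y => simp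

/-- Because of this, a merely `K`-linear section of modules becomes a colinear one after tensoring
with `H`. -/
theorem isColinear_rTensor {W : Type*} [AddCommGroup W] [Module K W] (f : V →ₗ[K] W) :
    IsColinear (cofreeComodule K H V) (cofreeComodule K H W) (f.rTensor H) := by
  refine TensorProduct.ext' fun v h => ?_
  simp only [LinearMap.comp_apply, LinearMap.rTensor_tmul, cofreeComodule_coact_tmul]
  generalize comul (R := K) h = p
  induction p with
  | zero => simp
  | add x y hx hy => simp only [map_add, hx, hy]
  | tmul x y => simp

theorem isColinear_rTensor_comp_comul (δ : H →ₗ[K] V) :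
    IsColinear (regularComodule K H) (cofreeComodule K H V) (δ.rTensor H ∘ₗ comul) := by
  have key : ∀ t : H ⊗[K] H, (δ.rTensor H ∘ₗ comul (R := K)).rTensor H t =
      (TensorProduct.assoc K V H H).symm (δ.rTensor (H ⊗[K] H)
        (TensorProduct.assoc K H H H ((comul (R := K)).rTensor H t))) := by
    intro t
    induction t with
    | zero => simp
    | add x y hx hy => simp only [map_add, hx, hy]
    | tmul a b =>
      simp only [LinearMap.rTensor_tmul, LinearMap.comp_apply]
      generalize comul (R := K) a = p
      induction p with
      | zero => simp
      | add x y hx hy => simp only [map_add, TensorProduct.add_tmul, hx, hy]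
      | tmul x y => simp
  refine LinearMap.ext fun h => ?_
  simp only [LinearMap.comp_apply, regularComodule]
  rw [key, Coalgebra.coassoc_apply]
  simp only [cofreeComodule, LinearMap.comp_apply, LinearEquiv.coe_coe]
  generalize comul (R := K) h = p
  induction p with
  | zero => simp
  | add x y hx hy => simp only [map_add, hx, hy]
  | tmul x y => simp

variable (K H V) in
/-- The map `V ⊗ H → V`, `v ⊗ h ↦ ε(h) v`. -/
noncomputable def counitContract : V ⊗[K] H →ₗ[K] V :=
  (TensorProduct.rid K V).toLinearMap ∘ₗ (counit (R := K)).lTensor V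

@[simp] theorem counitContract_tmul (v : V) (h : H) :
    counitContract K H V (v ⊗ₜ h) = counit (R := K) h • v := by
  simp [counitContract]

theorem counitContract_comul (h : H) : counitContract K H H (comul (R := K) h) = h := by
  simp [counitContract]

theorem counitContract_rTensor {W : Type*} [AddCommGroup W] [Module K W] (f : V →ₗ[K] W)
    (t : V ⊗[K] H) : counitContract K H W (f.rTensor H t) = f (counitContract K H V t) := by
  induction t with
  | zero => simp
  | add x y hx hy => simp only [map_add, hx, hy]
  | tmul v k => simp

section Module

variable [Module H V] [IsScalarTower K H V]

variable (K H V) in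
theorem isComoduleBimodule_hopfBimodule :
    IsComoduleBimodule (regularComodule K H) (hopfBimodule K H V) (cofreeComodule K H V) where
  colinear_lact := by
    refine TensorProduct.ext' fun h t => ?_
    induction t with
    | zero => simp
    | add x y hx hy => simp only [TensorProduct.tmul_add, map_add, hx, hy]
    | tmul v k =>
      -- With `q = Δ(k)`, the two sides of colinearity are `F q` at the two iterated coproducts of
      -- `h`, so coassociativity identifies them.
      let F (q : H ⊗[K] H) : H ⊗[K] (H ⊗[K] H) →ₗ[K] (V ⊗[K] H) ⊗[K] H :=
        TensorProduct.lift ((LinearMap.rTensorHom H ∘ₗ TensorProduct.mk K V H ∘ₗ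
          (Algebra.lsmul K K V).toLinearMap.flip v).compl₂ (LinearMap.mulRight K q))
      have hF : ∀ q x s, F q (x ⊗ₜ s) = (TensorProduct.mk K V H (x • v)).rTensor H (s * q) :=
        fun q x s => rfl
      have h1 : ∀ t : H ⊗[K] H, (cofreeComodule K H V).coact
          (TensorProduct.map₂ (Algebra.lsmul K K V).toLinearMap (LinearMap.mul K H) t (v ⊗ₜ k)) =
          F (comul k) ((comul (R := K)).lTensor H t) := by
        intro t
        induction t with
        | zero => simp
        | add x y hx hy => simp only [map_add, LinearMap.add_apply, hx, hy]
        | tmul a b => simp [cofreeComodule_coact_tmul, hF]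
      have h2 : ∀ t q : H ⊗[K] H, (TensorProduct.lift (hopfBimodule K H V).lact).rTensor H
          ((LinearMap.mul' K H).lTensor (H ⊗[K] (V ⊗[K] H))
            (TensorProduct.tensorTensorTensorComm K H H (V ⊗[K] H) H
              (t ⊗ₜ (TensorProduct.mk K V H v).rTensor H q))) =
          F q (TensorProduct.assoc K H H H ((comul (R := K)).rTensor H t)) := by
        intro t q
        induction t with
        | zero => simp
        | add x y hx hy => simp only [map_add, TensorProduct.add_tmul, hx, hy]
        | tmul a b =>
          induction q with
          | zero =>
            have : F 0 = 0 := TensorProduct.ext' fun x s => by simp [hF]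
            simp [this]
          | add x y hx hy =>
            have : F (x + y) = F x + F y := TensorProduct.ext' fun x s => by simp [hF, mul_add]
            simp only [map_add, TensorProduct.tmul_add, this, LinearMap.add_apply, hx, hy]
          | tmul c d =>
            simp only [LinearMap.rTensor_tmul, TensorProduct.mk_apply, LinearMap.lTensor_tmul,
              TensorProduct.tensorTensorTensorComm_tmul, TensorProduct.lift.tmul,
              LinearMap.mul'_apply, hopfBimodule_lact]
            generalize comul (R := K) a = p
            induction p with
            | zero => simp
            | add x y hx hy =>
              simp only [map_add, TensorProduct.add_tmul, LinearMap.add_apply, hx, hy]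
            | tmul x y => simp [hF]
      simp only [LinearMap.comp_apply, TensorProduct.lift.tmul, hopfBimodule_lact, h1,
        RightComoduleStr.tensor, codiag, TensorProduct.map_tmul, LinearEquiv.coe_coe,
        cofreeComodule_coact_tmul, h2]
      rw [← Coalgebra.coassoc_apply]
      rfl
  colinear_ract := by
    refine TensorProduct.ext' fun t h => ?_
    induction t with
    | zero => simp
    | add x y hx hy => simp only [TensorProduct.add_tmul, map_add, hx, hy]
    | tmul v k =>
      simp only [LinearMap.comp_apply, TensorProduct.lift.tmul, LinearMap.flip_apply,
        hopfBimodule_ract_tmul, RightComoduleStr.tensor, codiag, TensorProduct.map_tmul,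
        LinearEquiv.coe_coe, cofreeComodule_coact_tmul, Bialgebra.comul_mul, regularComodule]
      generalize comul (R := K) k = p
      generalize comul (R := K) h = q
      induction p with
      | zero => simp
      | add x y hx hy => simp only [map_add, add_mul, TensorProduct.add_tmul, hx, hy]
      | tmul a b =>
        induction q with
        | zero => simp
        | add x y hx hy => simp only [map_add, mul_add, TensorProduct.tmul_add, hx, hy]
        | tmul c d => simp [hopfBimodule_ract_tmul]

theorem isBimoduleHom_rTensor {W : Type*} [AddCommGroup W] [Module K W] [Module H W]
    [IsScalarTower K H W] {f : V →ₗ[K] W} (hf : ∀ (h : H) v, f (h • v) = h • f v) :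
    IsBimoduleHom (hopfBimodule K H V) (hopfBimodule K H W) (f.rTensor H) where
  map_lact h t := by
    simp only [hopfBimodule_lact]
    generalize comul (R := K) h = p
    induction t with
    | zero => simp
    | add x y hx hy => simp only [map_add, hx, hy]
    | tmul v k =>
      induction p with
      | zero => simp
      | add x y hx hy => simp only [map_add, LinearMap.add_apply, hx, hy]
      | tmul a b => simp [hf]
  map_ract h t := by
    induction t with
    | zero => simp
    | add x y hx hy => simp only [map_add, hx, hy]
    | tmul v k => simp [hopfBimodule_ract_tmul]

theorem isDerivation_rTensor_comp_comul {δ : H →ₗ[K] V}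
    (hδ : ∀ h k, δ (h * k) = h • δ k + counit (R := K) k • δ h) :
    IsDerivation (hopfBimodule K H V) (δ.rTensor H ∘ₗ comul) := by
  -- For `q = Δ(k)` the right factor becomes `ε(k₁) k₂ = k`, giving the Leibniz rule.
  have key : ∀ p q : H ⊗[K] H, δ.rTensor H (p * q) =
      TensorProduct.map₂ (Algebra.lsmul K K V).toLinearMap (LinearMap.mul K H) p (δ.rTensor H q) +
      (hopfBimodule K H V).ract (TensorProduct.lid K H ((counit (R := K)).rTensor H q))
        (δ.rTensor H p) := by
    intro p q
    induction p with
    | zero => simp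
    | add x y hx hy =>
      simp only [map_add, add_mul, LinearMap.add_apply, hx, hy]
      abel
    | tmul a b =>
      induction q with
      | zero => simp
      | add x y hx hy =>
        simp only [map_add, mul_add, LinearMap.add_apply, hx, hy]
        abel
      | tmul c d =>
        simp [hδ, hopfBimodule_ract_tmul, TensorProduct.add_tmul, TensorProduct.smul_tmul']
  intro h k
  simp only [LinearMap.comp_apply, Bialgebra.comul_mul, key, Coalgebra.rTensor_counit_comul,
    TensorProduct.lid_tmul, one_smul, hopfBimodule_lact]

theorem counitContract_lact (h : H) (t : V ⊗[K] H) :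
    counitContract K H V ((hopfBimodule K H V).lact h t) = h • counitContract K H V t := by
  conv_rhs => rw [← counitContract_comul (K := K) h]
  rw [hopfBimodule_lact]
  generalize comul (R := K) h = p
  induction t with
  | zero => simp
  | add x y hx hy => simp only [map_add, smul_add, hx, hy]
  | tmul v k =>
    induction p with
    | zero => simp
    | add x y hx hy => simp only [map_add, add_smul, LinearMap.add_apply, hx, hy]
    | tmul a b => simp [mul_smul, smul_comm a]

theorem counitContract_ract (h : H) (t : V ⊗[K] H) :
    counitContract K H V ((hopfBimodule K H V).ract h t) =
      counit (R := K) h • counitContract K H V t := by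
  induction t with
  | zero => simp
  | add x y hx hy => simp only [map_add, smul_add, hx, hy]
  | tmul v k => simp [hopfBimodule_ract_tmul, mul_smul, smul_comm (counit (R := K) h)]

end Module

end HopfComodule

/-- Applying `ε` to the last factor of a lifted derivation `E` gives a cocycle in `H ⊗ H⁺`. The term
`ε(x) E(h)` of `E(h x)` vanishes for `x ∈ H⁺`, so the restriction to `H⁺` is left linear; it splits
the action because `E` lifts the derivation of `h ↦ h - ε(h)`. -/
theorem LiftsColinearDerivations.exists_isFsSection {K : Type*} [Field K] {H : Type*} [Ring H]
    [HopfAlgebra K H] (hH : LiftsColinearDerivations (regularComodule K H)) :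
    ∃ τ : augmentationIdeal K H →ₗ[K] H ⊗[K] augmentationIdeal K H, IsFsSection τ := by
  have hact : ∀ (h : H) t, augmentationAct K H (h • t) = h • augmentationAct K H t := by
    intro h t
    induction t with
    | zero => simp
    | add x y hx hy => simp only [smul_add, map_add, hx, hy]
    | tmul a x =>
      ext
      simp [TensorProduct.smul_tmul', augmentationAct_tmul, mul_assoc]
  have hs : augmentationAct K H ∘ₗ TensorProduct.mk K H (augmentationIdeal K H) 1 =
      LinearMap.id := by
    ext x
    simp [augmentationAct_tmul]
  obtain ⟨E, hE, -, hfE⟩ := hH ((H ⊗[K] augmentationIdeal K H) ⊗[K] H)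
    (augmentationIdeal K H ⊗[K] H) (hopfBimodule K H _) (cofreeComodule K H _)
    (hopfBimodule K H _) (cofreeComodule K H _)
    (isComoduleBimodule_hopfBimodule K H _) (isComoduleBimodule_hopfBimodule K H _)
    ((augmentationAct K H).rTensor H) (isBimoduleHom_rTensor hact) (isColinear_rTensor _)
    ⟨(TensorProduct.mk K H (augmentationIdeal K H) 1).rTensor H, isColinear_rTensor _, by
      rw [← LinearMap.rTensor_comp, hs, LinearMap.rTensor_id]⟩
    ((augmentationProj K H).rTensor H ∘ₗ Coalgebra.comul)
    (isDerivation_rTensor_comp_comul augmentationProj_mul) (isColinear_rTensor_comp_comul _)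
  refine ⟨counitContract K H _ ∘ₗ E ∘ₗ (augmentationIdeal K H).subtype.restrictScalars K,
    fun h x => ?_, fun x => ?_⟩
  · change counitContract K H _ (E (h * x)) = _
    rw [hE, map_add, counitContract_lact, counitContract_ract, counit_coe_augmentationIdeal,
      zero_smul, add_zero]
    rfl
  · change augmentationAct K H (counitContract K H _ (E x)) = x
    rw [← counitContract_rTensor, ← LinearMap.comp_apply (LinearMap.rTensor H _), hfE,
      LinearMap.comp_apply, counitContract_rTensor, counitContract_comul]
    ext
    rw [coe_augmentationProj, counit_coe_augmentationIdeal, map_zero, sub_zero]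

/-! ### Projectivity of the augmentation ideal -/

section AugmentationProjective

variable {K : Type*} [Field K] {H : Type*} [Ring H] [HopfAlgebra K H]

theorem projective_augmentationIdeal_iff_exists_isFsSection :
    Module.Projective H (augmentationIdeal K H) ↔
      ∃ τ : augmentationIdeal K H →ₗ[K] H ⊗[K] augmentationIdeal K H, IsFsSection τ := by
  constructor
  · intro _
    obtain ⟨τ, hτ⟩ := Module.projective_lifting_property (tensorAct K H (augmentationIdeal K H))
      LinearMap.id (tensorAct_surjective K H _)
    exact ⟨τ.restrictScalars K, τ.map_smul, LinearMap.congr_fun hτ⟩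
  · rintro ⟨τ, hτ⟩
    exact Module.Projective.of_split (M := H ⊗[K] augmentationIdeal K H)
      { toFun := τ, map_add' := τ.map_add, map_smul' := hτ.map_smul }
      (tensorAct K H (augmentationIdeal K H)) (LinearMap.ext hτ.mul_eq)

theorem exists_isFsSection_of_augmentationMul_section
    {σ : augmentationIdeal K H →ₗ[H] augmentationIdeal K H ⊗[K] augmentationIdeal K H}
    (hσ : ∀ x, augmentationMul K H (σ x) = x) :
    ∃ τ : augmentationIdeal K H →ₗ[K] H ⊗[K] augmentationIdeal K H, IsFsSection τ := by
  refine ⟨((augmentationIdeal K H).subtype.restrictScalars K).rTensor _ ∘ₗ σ.restrictScalars K,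
    fun h x => ?_, hσ⟩
  simp only [LinearMap.comp_apply, LinearMap.restrictScalars_apply, map_smul]
  generalize σ x = t
  induction t with
  | zero => simp
  | add x y hx hy => simp only [smul_add, map_add, hx, hy]
  | tmul a b => simp [TensorProduct.smul_tmul']

end AugmentationProjective

/-! ### Integrals in finite-dimensional hereditary Hopf algebras -/

section Integrals

open Coalgebra (comul counit)
open HopfAlgebra (antipode)

variable {K : Type*} [Field K] {H : Type*} [Ring H] [HopfAlgebra K H]

/-! ### Untwisting the diagonal action on `H ⊗ V` -/

section Twist

variable {V : Type*} [AddCommGroup V] [Module K V]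

/-- The map `k ⊗ v ↦ k₁ ⊗ ψ(k₂) v` on `H ⊗ V`, for `ψ : H → End V`. -/
noncomputable def comulTwist (ψ : H →ₗ[K] Module.End K V) : H ⊗[K] V →ₗ[K] H ⊗[K] V :=
  (TensorProduct.lift ψ).lTensor H ∘ₗ (TensorProduct.assoc K H H V).toLinearMap ∘ₗ
    (comul (R := K)).rTensor V

theorem comulTwist_tmul (ψ : H →ₗ[K] Module.End K V) (k : H) (v : V) :
    comulTwist ψ (k ⊗ₜ v) = (LinearMap.applyₗ v ∘ₗ ψ).lTensor H (comul (R := K) k) := by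
  simp only [comulTwist, LinearMap.comp_apply, LinearMap.rTensor_tmul, LinearEquiv.coe_coe]
  generalize comul (R := K) k = p
  induction p with
  | zero => simp
  | add x y hx hy => simp only [map_add, TensorProduct.add_tmul, hx, hy]
  | tmul a b => simp

/-- Both sides send `k ⊗ v` to `k₁ ⊗ ψ(k₂) χ(k₃) v`. Convolution inverses therefore give inverse
twists, which applies to `θ` and `θ ∘ S`. -/
theorem comulTwist_comulTwist (ψ χ : H →ₗ[K] Module.End K V) (w : H ⊗[K] V) :
    comulTwist ψ (comulTwist χ w) =
      comulTwist (WithConv.toConv ψ * WithConv.toConv χ).ofConv w := by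
  induction w with
  | zero => simp
  | add x y hx hy => simp only [map_add, hx, hy]
  | tmul k v =>
    have h1 : ∀ t : H ⊗[K] H, comulTwist ψ ((LinearMap.applyₗ v ∘ₗ χ).lTensor H t) =
        (LinearMap.applyₗ v ∘ₗ LinearMap.mul' K (Module.End K V) ∘ₗ
          TensorProduct.map ψ χ).lTensor H
            (TensorProduct.assoc K H H H ((comul (R := K)).rTensor H t)) := by
      intro t
      induction t with
      | zero => simp
      | add x y hx hy => simp only [map_add, hx, hy]
      | tmul a b =>
        simp only [LinearMap.lTensor_tmul, comulTwist_tmul, LinearMap.rTensor_tmul]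
        generalize comul (R := K) a = p
        induction p with
        | zero => simp
        | add x y hx hy => simp only [map_add, TensorProduct.add_tmul, hx, hy]
        | tmul x y => simp
    have h2 : LinearMap.applyₗ v ∘ₗ (WithConv.toConv ψ * WithConv.toConv χ).ofConv =
        (LinearMap.applyₗ v ∘ₗ LinearMap.mul' K (Module.End K V) ∘ₗ TensorProduct.map ψ χ) ∘ₗ
          comul (R := K) := rfl
    rw [comulTwist_tmul, comulTwist_tmul, h1, h2, Coalgebra.coassoc_apply,
      LinearMap.lTensor_comp _ _ (comul (R := K)), LinearMap.comp_apply]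

theorem comulTwist_one (w : H ⊗[K] V) :
    comulTwist (1 : WithConv (H →ₗ[K] Module.End K V)).ofConv w = w := by
  induction w with
  | zero => simp
  | add x y hx hy => simp only [map_add, hx, hy]
  | tmul k v =>
    have h : LinearMap.applyₗ v ∘ₗ (1 : WithConv (H →ₗ[K] Module.End K V)).ofConv =
        LinearMap.toSpanSingleton K V v ∘ₗ counit (R := K) (A := H) := by
      ext h
      simp [LinearMap.convOne_def]
    rw [comulTwist_tmul, h, LinearMap.lTensor_comp, LinearMap.comp_apply,
      Coalgebra.lTensor_counit_comul]
    simp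

/-- The twist carries the action on the first factor alone to the diagonal action. -/
theorem comulTwist_smul (θ : H →ₐ[K] Module.End K V) (h : H) (w : H ⊗[K] V) :
    comulTwist θ.toLinearMap (h • w) =
      TensorProduct.map₂ (LinearMap.mul K H) θ.toLinearMap (comul (R := K) h)
        (comulTwist θ.toLinearMap w) := by
  induction w with
  | zero => simp
  | add x y hx hy => simp only [smul_add, map_add, hx, hy]
  | tmul k v =>
    rw [TensorProduct.smul_tmul', comulTwist_tmul, comulTwist_tmul, smul_eq_mul,
      Bialgebra.comul_mul]
    generalize comul (R := K) h = p
    generalize comul (R := K) k = q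
    induction p with
    | zero => simp
    | add x y hx hy => simp only [map_add, add_mul, LinearMap.add_apply, hx, hy]
    | tmul a b =>
      induction q with
      | zero => simp
      | add x y hx hy => simp only [map_add, mul_add, hx, hy]
      | tmul c d => simp

theorem comulTwist_algHom_antipode (θ : H →ₐ[K] Module.End K V) (w : H ⊗[K] V) :
    comulTwist θ.toLinearMap (comulTwist (θ.toLinearMap ∘ₗ antipode K) w) = w := by
  have h := LinearMap.algHom_comp_convMul_distrib θ (WithConv.toConv LinearMap.id)
    (WithConv.toConv (antipode K (A := H)))
  rw [LinearMap.id_mul_antipode] at h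
  have h1 : WithConv.toConv θ.toLinearMap * WithConv.toConv (θ.toLinearMap ∘ₗ antipode K) = 1 := by
    refine WithConv.ext (Eq.trans h.symm ?_)
    ext x : 1
    simp [LinearMap.convOne_def]
  rw [comulTwist_comulTwist, h1, comulTwist_one]

theorem comulTwist_antipode_algHom (θ : H →ₐ[K] Module.End K V) (w : H ⊗[K] V) :
    comulTwist (θ.toLinearMap ∘ₗ antipode K) (comulTwist θ.toLinearMap w) = w := by
  have h := LinearMap.algHom_comp_convMul_distrib θ (WithConv.toConv (antipode K (A := H)))
    (WithConv.toConv LinearMap.id)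
  rw [LinearMap.antipode_mul_id] at h
  have h1 : WithConv.toConv (θ.toLinearMap ∘ₗ antipode K) * WithConv.toConv θ.toLinearMap = 1 := by
    refine WithConv.ext (Eq.trans h.symm ?_)
    ext x : 1
    simp [LinearMap.convOne_def]
  rw [comulTwist_comulTwist, h1, comulTwist_one]

end Twist

variable (K H) in
/-- The left action `(h f)(x) = f(S(h) x)` of `H` on its dual. -/
noncomputable def dualAction : H →ₐ[K] Module.End K (Module.Dual K H) :=
  AlgHom.ofLinearMap
    { toFun := fun h => LinearMap.lcomp K K (LinearMap.mulLeft K (antipode K h))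
      map_add' := fun h k => by ext; simp [add_mul]
      map_smul' := fun c h => by ext; simp }
    (by ext; simp)
    (fun h k => by ext; simp [HopfAlgebra.antipode_mul_antidistrib])

theorem dualAction_apply (h : H) (f : Module.Dual K H) (x : H) :
    dualAction K H h f x = f (antipode K h * x) := rfl

/-- Viewing `H ⊗ H*` as `End H`, the diagonal action becomes `F ↦ h₁ F(S(h₂) -)`. -/
theorem dualTensorHom_comm_dualAction (p : H ⊗[K] H) (w : H ⊗[K] Module.Dual K H) (x : H) :
    dualTensorHom K H H (TensorProduct.comm K _ _
      (TensorProduct.map₂ (LinearMap.mul K H) (dualAction K H).toLinearMap p w)) x =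
    TensorProduct.lift ((LinearMap.mul K H).compl₂
      (dualTensorHom K H H (TensorProduct.comm K _ _ w) ∘ₗ LinearMap.mulRight K x ∘ₗ
        antipode K)) p := by
  induction p with
  | zero => simp
  | add s t hs ht => simp only [map_add, LinearMap.add_apply, hs, ht]
  | tmul a b =>
    induction w with
    | zero => simp
    | add s t hs ht =>
      simp only [map_add, LinearMap.add_apply, hs, ht, TensorProduct.lift.tmul,
        LinearMap.compl₂_apply, LinearMap.comp_apply]
    | tmul k f => simp [dualAction_apply]

variable (K H) in
theorem exists_dual_tensor_ne_zero_smul_eq_counit_smul [FiniteDimensional K H] :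
    ∃ q : H ⊗[K] Module.Dual K H, q ≠ 0 ∧ ∀ h : H, h • q = counit (R := K) h • q := by
  have : Nontrivial H := by
    refine ⟨0, 1, fun h => zero_ne_one (α := K) ?_⟩
    rw [← map_zero (counit (R := K) (A := H)), h, Bialgebra.counit_one]
  let Ψ : H ⊗[K] Module.Dual K H ≃ₗ[K] (H →ₗ[K] H) :=
    TensorProduct.comm K _ _ ≪≫ₗ dualTensorHomEquiv K H H
  have hΨ : ∀ w, Ψ w = dualTensorHom K H H (TensorProduct.comm K _ _ w) := fun w => by
    simp [Ψ]
  -- The canonical element of `H ⊗ H*`. It is invariant under the diagonal action because `h₁ S(h₂)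
  -- x = ε(h) x`; untwisting it gives `q`.
  let c := Ψ.symm LinearMap.id
  have hc : dualTensorHom K H H (TensorProduct.comm K _ _ c) = LinearMap.id := by
    rw [← hΨ, LinearEquiv.apply_symm_apply]
  have hinv : ∀ h : H, TensorProduct.map₂ (LinearMap.mul K H) (dualAction K H).toLinearMap
      (comul (R := K) h) c = counit (R := K) h • c := by
    intro h
    refine Ψ.injective (LinearMap.ext fun x => ?_)
    have key : ∀ p : H ⊗[K] H, TensorProduct.lift ((LinearMap.mul K H).compl₂
        (LinearMap.id ∘ₗ LinearMap.mulRight K x ∘ₗ antipode K)) p =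
        LinearMap.mul' K H ((antipode K).lTensor H p) * x := by
      intro p
      induction p with
      | zero => simp
      | add s t hs ht => simp only [map_add, add_mul, hs, ht]
      | tmul a b => simp [mul_assoc]
    rw [hΨ, dualTensorHom_comm_dualAction, hc, key,
      HopfAlgebra.mul_antipode_lTensor_comul_apply, map_smul, hΨ, hc, LinearMap.smul_apply,
      LinearMap.id_apply, Algebra.smul_def]
  refine ⟨comulTwist ((dualAction K H).toLinearMap ∘ₗ antipode K) c, fun h0 => ?_, fun h => ?_⟩
  · have h1 := comulTwist_algHom_antipode (dualAction K H) c
    rw [h0, map_zero] at h1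
    rw [← h1, map_zero, map_zero] at hc
    exact one_ne_zero (LinearMap.congr_fun hc (1 : H)).symm
  · refine Function.LeftInverse.injective (comulTwist_antipode_algHom (dualAction K H)) ?_
    rw [comulTwist_smul, map_smul, comulTwist_algHom_antipode, hinv]

variable (K H) in
theorem exists_ne_zero_forall_smul_eq_counit_smul [FiniteDimensional K H] :
    ∃ q : H ⊗[K] H, q ≠ 0 ∧ ∀ h : H, h • q = counit (R := K) h • q := by
  obtain ⟨q, hq0, hq⟩ := exists_dual_tensor_ne_zero_smul_eq_counit_smul K H
  -- Any linear isomorphism will do, as `H` acts on the first factor only. It also places the module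
  -- in the universe of `H`, as `IsLeftHereditary` requires.
  let f := LinearEquiv.ofFinrankEq (Module.Dual K H) H Subspace.dual_finrank_eq
  have hf : ∀ (h : H) t, f.lTensor H (h • t) = h • f.lTensor H t := by
    intro h t
    induction t with
    | zero => simp
    | add x y hx hy => simp only [smul_add, map_add, hx, hy]
    | tmul x y => simp [TensorProduct.smul_tmul']
  exact ⟨f.lTensor H q, fun h => hq0 ((f.lTensor H).map_eq_zero_iff.1 h), fun h => by
    rw [← hf, hq, map_smul]⟩

theorem IsLeftHereditary.exists_integral.{u, v} {K : Type u} [Field K] {H : Type v} [Ring H]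
    [HopfAlgebra K H] [FiniteDimensional K H] (hH : IsLeftHereditary H) :
    ∃ e : H, counit (R := K) e = 1 ∧ ∀ h : H, h * e = counit (R := K) h • e := by
  obtain ⟨q, hq0, hq⟩ := exists_ne_zero_forall_smul_eq_counit_smul K H
  -- The submodule `H q` is the line `K q`, a copy of the trivial module; as a submodule of a free
  -- module it is projective, so `h ↦ h q` splits.
  let π := (LinearMap.toSpanSingleton H (H ⊗[K] H) q).rangeRestrict
  have := hH (H ⊗[K] H) inferInstance
    (LinearMap.toSpanSingleton H (H ⊗[K] H) q).range
  obtain ⟨s, hs⟩ := Module.projective_lifting_property π LinearMap.id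
    (LinearMap.surjective_rangeRestrict _)
  have h1 : s (π 1) • q = q := by
    have := congrArg Subtype.val (LinearMap.congr_fun hs (π 1))
    exact this.trans (one_smul H q)
  have h2 : ∀ h : H, π h = counit (R := K) h • π 1 := fun h => Subtype.ext (by
    change h • q = counit (R := K) h • (1 : H) • q
    rw [one_smul, hq])
  -- The integral is `e = s(q)`: `e q = q` forces `ε(e) = 1`, and `h e = s(h q) = ε(h) e`.
  refine ⟨s (π 1), ?_, fun h => ?_⟩
  · have h3 : (counit (R := K) (s (π 1)) - 1) • q = 0 := by
      rw [sub_smul, one_smul, ← hq, h1, sub_self]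
    exact sub_eq_zero.1 ((smul_eq_zero.1 h3).resolve_right hq0)
  · rw [← smul_eq_mul, ← map_smul, ← map_smul, smul_eq_mul, mul_one, h2,
      LinearMap.map_smul_of_tower]

theorem IsLeftHereditary.exists_augmentationMul_section [FiniteDimensional K H]
    (hH : IsLeftHereditary H) :
    ∃ σ : augmentationIdeal K H →ₗ[H] augmentationIdeal K H ⊗[K] augmentationIdeal K H,
      ∀ x, augmentationMul K H (σ x) = x := by
  obtain ⟨e, he, hint⟩ := hH.exists_integral (K := K)
  -- `1 - e` is a right identity for `H⁺`, since `x e = ε(x) e = 0` there.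
  let e' : augmentationIdeal K H := ⟨1 - e, by simp [RingHom.mem_ker, he]⟩
  refine ⟨{ toFun := fun x => x ⊗ₜ e'
            map_add' := fun x y => TensorProduct.add_tmul x y e'
            map_smul' := fun h x => rfl }, fun x => ?_⟩
  ext
  change (x : H) * (1 - e) = x
  rw [mul_sub, mul_one, hint, counit_coe_augmentationIdeal, zero_smul, sub_zero]

end Integrals

/-! ### The equivalences -/

theorem mainTheorem7 (K : Type*) [Field K] (H : Type*) [Ring H] [HopfAlgebra K H] :
    List.TFAE [
      IsFormallySmoothAlg K H,
      IsFormallySmoothComoduleAlg (regularComodule K H) (regularComodule_isComoduleAlgebra K H),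
      Module.Projective H (augmentationIdeal K H),
      ∃ τ : augmentationIdeal K H →ₗ[K] H ⊗[K] augmentationIdeal K H, IsFsSection τ,
      IsLeftHereditary H,
      IsHereditary H] ∧
    (FiniteDimensional K H →
      (IsFormallySmoothAlg K H ↔
        ∃ σ : augmentationIdeal K H →ₗ[H] augmentationIdeal K H ⊗[K] augmentationIdeal K H,
          ∀ x, augmentationMul K H (σ x) = x)) := by
  rw [isFormallySmoothAlg_iff_liftsDerivations,
    isFormallySmoothComoduleAlg_iff_liftsColinearDerivations]
  refine ⟨?_, fun _ => ⟨fun h => h.isLeftHereditary.exists_augmentationMul_section, ?_⟩⟩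
  · tfae_have 1 → 6 := fun h => ⟨h.isLeftHereditary, h.op.isLeftHereditary⟩
    tfae_have 6 → 5 := fun h => h.1
    tfae_have 5 → 3 := fun h => h H inferInstance _
    tfae_have 3 ↔ 4 := projective_augmentationIdeal_iff_exists_isFsSection
    tfae_have 4 → 1 := fun ⟨_, hτ⟩ => hτ.liftsDerivations
    tfae_have 4 → 2 := fun ⟨_, hτ⟩ => hτ.liftsColinearDerivations
    tfae_have 2 → 4 := fun h => h.exists_isFsSection
    tfae_finish
  · rintro ⟨σ, hσ⟩
    obtain ⟨τ, hτ⟩ := exists_isFsSection_of_augmentationMul_section hσ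
    exact hτ.liftsDerivations
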